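/- For a prime $p$ and an integer $\ell\ge 1$ let $\mathcal C_\ell$ be the class of functions $f_a:\mathbb F_p^\ell\to\{\pm1\}$, $a\in\mathbb F_p^\ell$, where $f_a(z)=+1$ if $z_\ell=a_1z_1+\dots+a_{\ell-1}z_{\ell-1}+a_\ell$ and $f_a(z)=-1$ otherwise. For a distribution $D$ on a set $X$, an oracle $\mathsf{STAT}^{(k)}_D(\tau)$ answers every query $\phi:X^k\to[-1,1]$ with some $v$ such that $|v-\mathbb E_{x\sim D^k}[\phi(x)]|\le\tau$. A $k$-wise SQ algorithm adaptively asks such queries and then outputs a hypothesis. It learns a class $\mathcal C$ of functions $Z\to\{\pm1\}$ distribution-independently with error $\epsilon$ and failure probability $\delta$ from $\mathsf{STAT}^{(k)}(\tau)$ if for every distribution $P$ on $Z$, every $f\in\mathcal C$ and every oracle $\mathsf{STAT}^{(k)}_{P^f}(\tau)$, where $P^f$ is the distribution of $(z,f(z))$ with $z\sim P$, it outputs, with probability at least $1-\delta$ over its own randomness, a hypothesis $h$ with $\Pr_{z\sim P}[h(z)\ne f(z)]\le\epsilon$. The $k$-wise SQ complexity of learning $\mathcal C$ with error $\epsilon$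 and failure probability $\delta$ is the smallest $m\ge1$ such that some possibly randomized algorithm does so with at most $m$ queries to $\mathsf{STAT}^{(k)}(1/m)$. 1. (Upper bound.) For every $k\ge1$ there is a constant $c=c(k)>0$ such that for every prime $p$ there is a positive integer $t\le c\log p$ such that for every $\epsilon>0$ some deterministic algorithm learns $\mathcal C_{k+1}$ distribution-independently with error $\epsilon$ using at most $t$ queries to $\mathsf{STAT}^{(k+1)}(\epsilon^{k+1}/t)$. 2. (Lower bound.) For every $\delta\in[0,1)$ there is a constant $c=c(\delta)>0$ such that for all primes $p$ and all integers $k\ge1$ and $\ell\ge k+1$ there is a real $t\ge c\,p^{(\ell-k)/4}$ such that every possibly randomized algorithm that learns $\mathcal C_\ell$ distribution-independently with error $1/2-2/t$ and failure probability $\delta$ from $\mathsf{STAT}^{(k)}(1/t)$ needs at least $t$ queries. 3. (Separation.) For all $k\ge1$, $\epsilon\in(0,1/2)$ and $\delta\in[0,1)$ there are constants $c_1,c_2>0$, depending only on $k,\epsilon,\delta$, such that for every prime $p$ the $(k+1)$-wise SQ complexity of learning $\mathcal C_{k+1}$ with error $\epsilon$ and failure probability $\delta$ is at most $c_1\log p$,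 whereas its $k$-wise SQ complexity is at least $c_2\,p^{1/4}$. -/

import Mathlib

open scoped ENNReal

noncomputable section

namespace KWiseSQ

/-- The expectation `D^k[φ]` of `φ` over `k` i.i.d. draws from `D`, for a finite domain. -/
def expect {X : Type} [Fintype X] {k : ℕ} (D : PMF X) (φ : (Fin k → X) → ℝ) : ℝ :=
  ∑ x : Fin k → X, (∏ i, (D (x i)).toReal) * φ x

/-- A `k`-wise statistical query over the domain `X`: a function `X^k → [-1, 1]`. -/
abbrev Query (k : ℕ) (X : Type) : Type := (Fin k → X) → Set.Icc (-1 : ℝ) 1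

/-- `O` is a `k`-wise statistical query oracle for `D` of tolerance `τ`. -/
def IsSTAT {X : Type} [Fintype X] {k : ℕ} (D : PMF X) (τ : ℝ) (O : Query k X → ℝ) : Prop :=
  ∀ φ : Query k X, |O φ - expect D (fun x => (φ x : ℝ))| ≤ τ

/-- A deterministic adaptive `k`-wise SQ algorithm over samples in `X` with outputs in `H`:
it either stops with an output, or asks a query and continues depending on the answer. -/
inductive SQAlg (k : ℕ) (X H : Type) : Type
  | output (h : H) : SQAlg k X H
  | query (φ : Query k X) (next : ℝ → SQAlg k X H) : SQAlg k X H

/-- The output of an SQ algorithm when its queries are answered by `O`. -/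
def SQAlg.run {k : ℕ} {X H : Type} (O : Query k X → ℝ) : SQAlg k X H → H
  | .output h => h
  | .query φ next => (next (O φ)).run O

/-- The number of queries an SQ algorithm asks when its queries are answered by `O`. -/
def SQAlg.numQueries {k : ℕ} {X H : Type} (O : Query k X → ℝ) : SQAlg k X H → ℕ
  | .output _ => 0
  | .query φ next => (next (O φ)).numQueries O + 1

/-- The distribution `P^f` of the labeled example `(z, f z)` with `z ∼ P`; labels are `±1`. -/
def labeled {Z : Type} (P : PMF Z) (f : Z → ℤˣ) : PMF (Z × ℤˣ) :=
  P.map fun z => (z, f z)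

/-- The error `Pr_{z ∼ P}[h z ≠ f z]` of the hypothesis `h`. -/
def err {Z : Type} [Fintype Z] (P : PMF Z) (f h : Z → ℤˣ) : ℝ :=
  ∑ z with h z ≠ f z, (P z).toReal

/-- Distribution-independent PAC learnability of `C` with error at most `ε` by a deterministic
algorithm asking at most `q` queries to a `k`-wise SQ oracle of tolerance `τ`. -/
def DetLearnable {Z : Type} [Fintype Z] (k : ℕ) (C : Set (Z → ℤˣ)) (ε τ : ℝ) (q : ℕ) : Prop :=
  ∃ A : SQAlg k (Z × ℤˣ) (Z → ℤˣ),
    ∀ (P : PMF Z), ∀ f ∈ C, ∀ O : Query k (Z × ℤˣ) → ℝ, IsSTAT (labeled P f) τ O →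
      A.numQueries O ≤ q ∧ err P f (A.run O) ≤ ε

/-- Distribution-independent PAC learnability of `C` with error at most `ε` and failure
probability at most `δ` by a randomized algorithm asking at most `q` queries to a `k`-wise SQ
oracle of tolerance `τ`. A randomized algorithm is a deterministic one depending on a random
seed `ω`. The failure event is measured by the outer measure, so that no measurability of the
family `A` has to be assumed. -/
def RandLearnable {Z : Type} [Fintype Z] (k : ℕ) (C : Set (Z → ℤˣ)) (ε δ τ : ℝ) (q : ℕ) :
    Prop :=
  ∃ (Ω : Type) (_ : MeasurableSpace Ω) (μ : MeasureTheory.Measure Ω)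
    (_ : MeasureTheory.IsProbabilityMeasure μ) (A : Ω → SQAlg k (Z × ℤˣ) (Z → ℤˣ)),
    ∀ (P : PMF Z), ∀ f ∈ C, ∀ O : Query k (Z × ℤˣ) → ℝ, IsSTAT (labeled P f) τ O →
      (∀ ω, (A ω).numQueries O ≤ q) ∧
        μ {ω | ε < err P f ((A ω).run O)} ≤ ENNReal.ofReal δ

/-- The `k`-wise SQ complexity of PAC learning `C` with error `ε` and failure probability `δ`:
the smallest positive `m` such that `m` queries of tolerance `1/m` suffice (`⊤` if none does). -/
def sqComplexity {Z : Type} [Fintype Z] (k : ℕ) (C : Set (Z → ℤˣ)) (ε δ : ℝ) : ℕ∞ :=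
  ⨅ (m : ℕ) (_ : 0 < m ∧ RandLearnable k C ε δ (1 / (m : ℝ)) m), (m : ℕ∞)

/-- The affine hyperplane `z_ℓ = a_1 z_1 + ⋯ + a_{ℓ-1} z_{ℓ-1} + a_ℓ` of `𝔽_p^ℓ`, `ℓ = n + 1`. -/
def hyp {p n : ℕ} (a : Fin (n + 1) → ZMod p) : Set (Fin (n + 1) → ZMod p) :=
  {z | z (Fin.last n) = ∑ i : Fin n, a i.castSucc * z i.castSucc + a (Fin.last n)}

open Classical in
/-- The `±1` indicator of `hyp a`. -/
def hypFun {p n : ℕ} (a : Fin (n + 1) → ZMod p) : (Fin (n + 1) → ZMod p) → ℤˣ :=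
  fun z => if z ∈ hyp a then 1 else -1

/-- The concept class `C_ℓ` of `±1` indicators of hyperplanes in `𝔽_p^ℓ`, where `ℓ = n + 1`. -/
def hypClass (p n : ℕ) : Set ((Fin (n + 1) → ZMod p) → ℤˣ) :=
  Set.range hypFun

end KWiseSQ

end

/-!
**Upper bound.** In homogeneous coordinates the positive points of a hyperplane of `𝔽_p^(k+1)` lie
in a subspace of dimension `k + 1`, and a `(k + 1)`-wise query sees the spans of linearly
independent tuples of positive examples. Fix thresholds `θ_d` decreasing geometrically, and let `d`
be least such that some subspace `U` of dimension at most `d` misses positive examples of weight at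
most `θ_d`. By minimality a subspace of dimension `i < d` misses weight more than `θ_i`, so
independent `d`-tuples have substantial weight; as `θ_d` is small compared with `θ_{d-1}`, most of
them span exactly `U`. A majority vote of the spans then reveals the bits of a code for `U`, and
there are at most `p^((k+2)^2)` subspaces, so `O(log p)` bits suffice.

**Lower bound.** Make each of the two labels equally likely. Two hyperplanes that are not parallel
then give distributions of labeled examples whose densities relative to the uniform distribution are
uncorrelated, so by Cauchy–Schwarz a `k`-wise query of tolerance `τ` separates few of the `p^ℓ`
hyperplanes from uniform labels. An adversary answers as for uniform labels whenever the tolerance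
permits; along the resulting path each query, and the comparison of the output with the labels,
rules out only those few hyperplanes.
-/

noncomputable section

namespace KWiseSQ

section Expectation

variable {X Y : Type} [Fintype X]

lemma sum_toReal_eq_one (D : PMF X) : ∑ x, (D x).toReal = 1 := by
  rw [← ENNReal.toReal_sum fun x _ => D.apply_ne_top x, ← tsum_fintype (L := .unconditional X),
    D.tsum_coe, ENNReal.toReal_one]

lemma toReal_map_apply [DecidableEq Y] (D : PMF X) (g : X → Y) (y : Y) :
    (D.map g y).toReal = ∑ x, if y = g x then (D x).toReal else 0 := by
  rw [PMF.map_apply, tsum_fintype, ENNReal.toReal_sum fun x _ => by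
    split_ifs <;> simp [D.apply_ne_top]]
  refine Finset.sum_congr rfl fun x _ => ?_
  split_ifs <;> simp

lemma expect_map [Fintype Y] {k : ℕ} (D : PMF X) (g : X → Y) (φ : (Fin k → Y) → ℝ) :
    expect (D.map g) φ = expect D fun x => φ (g ∘ x) := by
  classical
  have prod_eq (y : Fin k → Y) : ∏ i, (D.map g (y i)).toReal =
      ∑ x : Fin k → X, if y = g ∘ x then ∏ i, (D (x i)).toReal else 0 := by
    simp_rw [toReal_map_apply, Finset.prod_univ_sum, Fintype.prod_ite_zero, funext_iff,
      Fintype.piFinset_univ, Function.comp_apply]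
    congr!
  simp_rw [expect, prod_eq, Finset.sum_mul, ite_mul, zero_mul]
  rw [Finset.sum_comm]
  simp

lemma expect_comp_castLE {j k : ℕ} (D : PMF X) (h : j ≤ k) (φ : (Fin j → X) → ℝ) :
    expect D (fun x => φ (x ∘ Fin.castLE h)) = expect D φ := by
  induction k, h using Nat.le_induction with
  | base => rfl
  | succ k h ih =>
    have snoc_comp (x : Fin k → X) (z : X) :
        (Fin.snoc x z : Fin (k + 1) → X) ∘ Fin.castLE (h.trans k.le_succ) =
          x ∘ Fin.castLE h :=
      funext fun i => Fin.snoc_castSucc (α := fun _ => X) z x (Fin.castLE h i)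
    rw [← ih, expect, ← (Fin.snocEquiv fun _ => X).sum_comp, Fintype.sum_prod_type_right]
    refine Finset.sum_congr rfl fun x _ => ?_
    change ∑ z, (∏ i, (D ((Fin.snoc x z : Fin (k + 1) → X) i)).toReal) *
      φ ((Fin.snoc x z : Fin (k + 1) → X) ∘ Fin.castLE _) = _
    simp only [Fin.prod_univ_castSucc, Fin.snoc_castSucc, Fin.snoc_last, snoc_comp]
    rw [← Finset.sum_mul, ← Finset.mul_sum, sum_toReal_eq_one, mul_one]

lemma expect_apply_zero {k : ℕ} [NeZero k] (D : PMF X) (g : X → ℝ) :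
    expect D (fun x : Fin k → X => g (x 0)) = ∑ x, (D x).toReal * g x := by
  have h := expect_comp_castLE D (NeZero.one_le (n := k)) fun x : Fin 1 → X => g (x 0)
  refine h.trans ?_
  simp [expect, ← (Equiv.funUnique (Fin 1) X).symm.sum_comp, uniqueElim_const]

lemma isSTAT_expect {k : ℕ} (D : PMF X) {τ : ℝ} (hτ : 0 ≤ τ) :
    IsSTAT D τ fun φ : Query k X => expect D fun x => (φ x : ℝ) := fun φ => by
  simpa using hτ

end Expectation

section Error

variable {Z : Type} [Fintype Z] (P : PMF Z) (f h : Z → ℤˣ)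

lemma err_nonneg : 0 ≤ err P f h :=
  Finset.sum_nonneg fun _ _ => ENNReal.toReal_nonneg

lemma err_le_one : err P f h ≤ 1 := by
  rw [← sum_toReal_eq_one P]
  exact Finset.sum_le_sum_of_subset_of_nonneg (Finset.filter_subset _ _)
    fun _ _ _ => ENNReal.toReal_nonneg

/-- The `k`-wise query measuring the correlation of `h` with the label of the first example. -/
def corrQuery (k : ℕ) [NeZero k] (h : Z → ℤˣ) : Query k (Z × ℤˣ) := fun x =>
  ⟨((x 0).2 * h (x 0).1 : ℤˣ), by
    rcases Int.units_eq_one_or ((x 0).2 * h (x 0).1) with e | e <;> simp [e]⟩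

lemma expect_labeled_corrQuery (k : ℕ) [NeZero k] :
    expect (labeled P f) (fun x => (corrQuery k h x : ℝ)) = 1 - 2 * err P f h := by
  have val (z : Z) : (((f z * h z : ℤˣ) : ℤ) : ℝ) = 1 - 2 * if h z ≠ f z then 1 else 0 := by
    rcases Int.units_eq_one_or (f z) with e | e <;>
      rcases Int.units_eq_one_or (h z) with e' | e' <;> norm_num [e, e']
  have key := expect_apply_zero (k := k) P fun z => (((f z * h z : ℤˣ) : ℤ) : ℝ)
  rw [labeled, expect_map]
  refine key.trans ?_
  simp only [val, mul_sub, mul_one, Finset.sum_sub_distrib, sum_toReal_eq_one, err,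
    Finset.sum_filter, Finset.mul_sum, mul_ite, mul_zero, mul_comm _ (2 : ℝ)]

end Error

section Algorithms

variable {X H : Type} {k : ℕ}

lemma SQAlg.exists_batch {ι : Type} [Fintype ι] (φ : ι → Query k X)
    (next : (ι → ℝ) → SQAlg k X H) :
    ∃ A : SQAlg k X H, ∀ O : Query k X → ℝ,
      A.run O = (next (O ∘ φ)).run O ∧
        A.numQueries O = Fintype.card ι + (next (O ∘ φ)).numQueries O := by
  suffices ∀ (n : ℕ) (φ : Fin n → Query k X) (next : (Fin n → ℝ) → SQAlg k X H),
      ∃ A : SQAlg k X H, ∀ O : Query k X → ℝ,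
        A.run O = (next (O ∘ φ)).run O ∧
          A.numQueries O = n + (next (O ∘ φ)).numQueries O by
    let e := Fintype.equivFin ι
    obtain ⟨A, hA⟩ := this _ (φ ∘ e.symm) fun a => next (a ∘ e)
    exact ⟨A, fun O => by simpa [Function.comp_def] using hA O⟩
  intro n
  induction n with
  | zero =>
    intro φ next
    refine ⟨next Fin.elim0, fun O => ?_⟩
    simp [Subsingleton.elim (O ∘ φ) Fin.elim0]
  | succ n ih =>
    intro φ next
    choose B hB using fun v : ℝ => ih (Fin.tail φ) fun a => next (Fin.cons v a)
    refine ⟨.query (φ 0) B, fun O => ?_⟩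
    have answers : (Fin.cons (O (φ 0)) (O ∘ Fin.tail φ) : Fin (n + 1) → ℝ) = O ∘ φ :=
      Fin.cons_self_tail (O ∘ φ)
    obtain ⟨hrun, hnum⟩ := hB (O (φ 0)) O
    rw [answers] at hrun hnum
    exact ⟨hrun, by rw [SQAlg.numQueries, hnum, add_right_comm]⟩

variable {Z : Type} [Fintype Z] {C : Set (Z → ℤˣ)} {ε τ : ℝ}

lemma DetLearnable.mono {ε' τ' : ℝ} {q q' : ℕ} (h : DetLearnable k C ε τ q)
    (hε : ε ≤ ε') (hτ : τ' ≤ τ) (hq : q ≤ q') : DetLearnable k C ε' τ' q' := by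
  obtain ⟨A, hA⟩ := h
  refine ⟨A, fun P f hf O hO => ?_⟩
  obtain ⟨h1, h2⟩ := hA P f hf O fun φ => (hO φ).trans hτ
  exact ⟨h1.trans hq, h2.trans hε⟩

lemma detLearnable_of_candidates [NeZero k] {ι κ : Type} [Fintype ι] [Fintype κ] [Nonempty κ]
    (φ : ι → Query k (Z × ℤˣ)) (h : (ι → ℝ) → κ → Z → ℤˣ)
    (exists_good : ∀ P : PMF Z, ∀ f ∈ C, ∀ a : ι → ℝ,
      (∀ i, |a i - expect (labeled P f) (fun x => (φ i x : ℝ))| ≤ τ) →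
        ∃ c, err P f (h a c) + τ ≤ ε) :
    DetLearnable k C ε τ (Fintype.card ι + Fintype.card κ) := by
  choose best hbest using fun b : κ → ℝ => Finite.exists_max b
  choose test htest using fun a : ι → ℝ =>
    SQAlg.exists_batch (fun c => corrQuery k (h a c)) fun b => .output (h a (best b))
  obtain ⟨A, hA⟩ := SQAlg.exists_batch φ test
  refine ⟨A, fun P f hf O hO => ?_⟩
  obtain ⟨c, hc⟩ := exists_good P f hf (O ∘ φ) fun i => hO (φ i)
  let b : κ → ℝ := O ∘ fun c => corrQuery k (h (O ∘ φ) c)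
  have close (c : κ) : |b c - (1 - 2 * err P f (h (O ∘ φ) c))| ≤ τ := by
    rw [← expect_labeled_corrQuery (k := k)]
    exact hO _
  rw [(hA O).1, (hA O).2, (htest _ O).1, (htest _ O).2]
  refine ⟨le_rfl, ?_⟩
  change err P f (h (O ∘ φ) (best b)) ≤ ε
  linarith [hbest b c, abs_le.1 (close c), abs_le.1 (close (best b))]

end Algorithms

section IndependentTuples

variable (K : Type*) {V Z : Type*} [DivisionRing K] [AddCommGroup V] [Module K V]
  (u : Z → V) (w : Z → ℝ)

/-- The span of the vectors attached to a tuple of points. -/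
def tupleSpan {j : ℕ} (x : Fin j → Z) : Submodule K V :=
  Submodule.span K (Set.range (u ∘ x))

open Classical in
/-- The product weight of a tuple whose vectors are linearly independent, and zero for every other
tuple. -/
def indepWeight {j : ℕ} (x : Fin j → Z) : ℝ :=
  if LinearIndependent K (u ∘ x) then ∏ i, w (x i) else 0

variable {K u w}

lemma finrank_tupleSpan_le {j : ℕ} (x : Fin j → Z) : Module.finrank K (tupleSpan K u x) ≤ j :=
  (finrank_range_le_card (u ∘ x)).trans_eq (Fintype.card_fin j)

lemma tupleSpan_le {j : ℕ} {x : Fin j → Z} {U : Submodule K V} :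
    tupleSpan K u x ≤ U ↔ ∀ i, u (x i) ∈ U :=
  Submodule.span_le.trans Set.range_subset_iff

lemma tupleSpan_eq_of_forall_mem [FiniteDimensional K V] {j : ℕ} {x : Fin j → Z}
    {U : Submodule K V} (hx : LinearIndependent K (u ∘ x)) (hU : Module.finrank K U ≤ j)
    (hmem : ∀ i, u (x i) ∈ U) : tupleSpan K u x = U := by
  have hdim : Module.finrank K (tupleSpan K u x) = j :=
    (finrank_span_eq_card hx).trans (Fintype.card_fin j)
  exact Submodule.eq_of_le_of_finrank_le (tupleSpan_le.2 hmem) (hU.trans_eq hdim.symm)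

lemma indepWeight_nonneg (hw : ∀ z, 0 ≤ w z) {j : ℕ} (x : Fin j → Z) :
    0 ≤ indepWeight K u w x := by
  unfold indepWeight
  split_ifs
  exacts [Finset.prod_nonneg fun i _ => hw _, le_rfl]

open Classical in
lemma indepWeight_cons {j : ℕ} (z : Z) (x : Fin j → Z) :
    indepWeight K u w (Fin.cons z x : Fin (j + 1) → Z) =
      indepWeight K u w x * (if u z ∈ tupleSpan K u x then 0 else w z) := by
  rw [indepWeight, Fin.comp_cons u z x, linearIndependent_finCons, Fin.prod_univ_succ]
  by_cases h1 : LinearIndependent K (u ∘ x) <;>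
    by_cases h2 : u z ∈ tupleSpan K u x <;>
    simp_all [indepWeight, tupleSpan, mul_comm]

lemma indepWeight_eq_mul_removeNth {j : ℕ} {x : Fin (j + 1) → Z}
    (hx : LinearIndependent K (u ∘ x)) (i : Fin (j + 1)) :
    indepWeight K u w x = w (x i) * indepWeight K u w (i.removeNth x) := by
  have hx' : LinearIndependent K (u ∘ i.removeNth x) := hx.comp _ Fin.succAbove_right_injective
  rw [indepWeight, indepWeight, if_pos hx, if_pos hx']
  exact Fin.prod_univ_succAbove _ i

variable [Fintype Z] (K u w)

/-- The total product weight of all linearly independent `j`-tuples. -/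
def indepMass (j : ℕ) : ℝ :=
  ∑ x : Fin j → Z, indepWeight K u w x

variable {K}

open Classical in
/-- The weight of the points whose vectors lie outside `U`. -/
def massOff (U : Submodule K V) : ℝ :=
  ∑ z, if u z ∈ U then 0 else w z

open Classical in
/-- The product weight of the linearly independent `j`-tuples whose span is not `U`. -/
def strayMass (j : ℕ) (U : Submodule K V) : ℝ :=
  ∑ x : Fin j → Z, if tupleSpan K u x = U then 0 else indepWeight K u w x

open Classical in
/-- The product weight of the linearly independent `j`-tuples whose span belongs to `S`, minus that
of those whose span does not. -/
def spanMargin (j : ℕ) (S : Set (Submodule K V)) : ℝ :=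
  ∑ x : Fin j → Z, indepWeight K u w x * if tupleSpan K u x ∈ S then 1 else -1

variable {u w}

lemma indepMass_zero : indepMass K u w 0 = 1 := by
  simp [indepMass, indepWeight]

lemma indepMass_nonneg (hw : ∀ z, 0 ≤ w z) (j : ℕ) : 0 ≤ indepMass K u w j :=
  Finset.sum_nonneg fun x _ => indepWeight_nonneg hw x

lemma indepMass_succ (j : ℕ) :
    indepMass K u w (j + 1) =
      ∑ x : Fin j → Z, indepWeight K u w x * massOff u w (tupleSpan K u x) := by
  simp only [indepMass, massOff, Finset.mul_sum]
  rw [← (Fin.consEquiv fun _ => Z).sum_comp, Fintype.sum_prod_type_right]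
  exact Finset.sum_congr rfl fun x _ => Finset.sum_congr rfl fun z _ => indepWeight_cons z x

lemma mul_indepMass_le_indepMass_succ (hw : ∀ z, 0 ≤ w z) {j : ℕ} {θ : ℝ}
    (hθ : ∀ U : Submodule K V, Module.finrank K U ≤ j → θ ≤ massOff u w U) :
    θ * indepMass K u w j ≤ indepMass K u w (j + 1) := by
  rw [indepMass_succ, indepMass, mul_comm, Finset.sum_mul]
  exact Finset.sum_le_sum fun x _ => mul_le_mul_of_nonneg_left
    (hθ _ (finrank_tupleSpan_le x)) (indepWeight_nonneg hw x)

lemma prod_range_le_indepMass {d : ℕ} {θ : ℕ → ℝ} (hθ : ∀ i, 0 ≤ θ i)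
    (growth : ∀ i < d, θ i * indepMass K u w i ≤ indepMass K u w (i + 1)) :
    ∏ i ∈ Finset.range d, θ i ≤ indepMass K u w d := by
  induction d with
  | zero => simp [indepMass_zero]
  | succ d ih =>
    rw [Finset.prod_range_succ, mul_comm]
    exact (mul_le_mul_of_nonneg_left (ih fun i hi => growth i (by lia)) (hθ d)).trans
      (growth d d.lt_succ_self)

lemma sum_mul_indepWeight_removeNth {j : ℕ} (i : Fin (j + 1)) (g : Z → ℝ) :
    ∑ x : Fin (j + 1) → Z, g (x i) * indepWeight K u w (i.removeNth x) =
      (∑ z, g z) * indepMass K u w j := by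
  have restrict (z : Z) (y : Fin j → Z) :
      i.removeNth (Fin.insertNthEquiv (fun _ => Z) i (z, y)) = y :=
    Fin.removeNth_insertNth (α := fun _ => Z) i z y
  rw [← (Fin.insertNthEquiv (fun _ => Z) i).sum_comp, Fintype.sum_prod_type, indepMass,
    Finset.sum_mul_sum]
  simp only [restrict, Fin.insertNthEquiv_apply, Fin.insertNth_apply_same]

section Stray

variable [FiniteDimensional K V] {U : Submodule K V}

lemma strayMass_zero (hU : Module.finrank K U ≤ 0) : strayMass u w 0 U = 0 :=
  Finset.sum_eq_zero fun _ _ =>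
    if_pos (tupleSpan_eq_of_forall_mem linearIndependent_empty_type hU fun i => i.elim0)

open Classical in
lemma strayMass_succ_le (hw : ∀ z, 0 ≤ w z) {j : ℕ} (hU : Module.finrank K U ≤ j + 1) :
    strayMass u w (j + 1) U ≤ (j + 1) * massOff u w U * indepMass K u w j := by
  let offWeight (z : Z) : ℝ := if u z ∈ U then 0 else w z
  have nonneg (x : Fin (j + 1) → Z) (i) :
      0 ≤ offWeight (x i) * indepWeight K u w (i.removeNth x) :=
    mul_nonneg (by dsimp only [offWeight]; split_ifs <;> simp [hw]) (indepWeight_nonneg hw _)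
  have stray_le (x : Fin (j + 1) → Z) : (if tupleSpan K u x = U then 0 else indepWeight K u w x) ≤
      ∑ i, offWeight (x i) * indepWeight K u w (i.removeNth x) := by
    split_ifs with hspan
    · exact Finset.sum_nonneg fun i _ => nonneg x i
    by_cases hx : LinearIndependent K (u ∘ x)
    · obtain ⟨i, hi⟩ : ∃ i, u (x i) ∉ U := by
        by_contra! hmem
        exact hspan (tupleSpan_eq_of_forall_mem hx hU hmem)
      calc indepWeight K u w x = offWeight (x i) * indepWeight K u w (i.removeNth x) := by
            simp only [offWeight, if_neg hi, indepWeight_eq_mul_removeNth hx i]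
        _ ≤ _ := Finset.single_le_sum (fun i _ => nonneg x i) (Finset.mem_univ i)
    · rw [indepWeight, if_neg hx]
      exact Finset.sum_nonneg fun i _ => nonneg x i
  calc strayMass u w (j + 1) U
      ≤ ∑ x : Fin (j + 1) → Z, ∑ i, offWeight (x i) * indepWeight K u w (i.removeNth x) :=
        Finset.sum_le_sum fun x _ => stray_le x
    _ = ∑ _i : Fin (j + 1), massOff u w U * indepMass K u w j := by
        rw [Finset.sum_comm]
        exact Finset.sum_congr rfl fun i _ => sum_mul_indepWeight_removeNth i offWeight
    _ = (j + 1) * massOff u w U * indepMass K u w j := by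
        simp [mul_assoc]

lemma exists_dominant_subspace (hw : ∀ z, 0 ≤ w z) {l : ℕ} {θ : ℕ → ℝ} (hθ_nonneg : ∀ i, 0 ≤ θ i)
    (hθ : ∀ i < l, 4 * (i + 1) * θ (i + 1) ≤ θ i) {T : Submodule K V}
    (hT : Module.finrank K T ≤ l) (hTθ : massOff u w T ≤ θ l) :
    ∃ d ≤ l, ∃ U : Submodule K V, massOff u w U ≤ θ d ∧
      ∏ i ∈ Finset.range d, θ i ≤ indepMass K u w d ∧
      4 * strayMass u w d U ≤ indepMass K u w d := by
  classical
  -- Below the least `d` admitting such a `U`, every span misses much weight, so `indepMass` grows.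
  have hex : ∃ d, ∃ U : Submodule K V, Module.finrank K U ≤ d ∧ massOff u w U ≤ θ d :=
    ⟨l, T, hT, hTθ⟩
  let d := Nat.find hex
  have hdl : d ≤ l := Nat.find_min' hex ⟨T, hT, hTθ⟩
  obtain ⟨U, hU, hUθ⟩ := Nat.find_spec hex
  have growth (i : ℕ) (hi : i < d) : θ i * indepMass K u w i ≤ indepMass K u w (i + 1) :=
    mul_indepMass_le_indepMass_succ hw fun U' hU' =>
      le_of_not_ge fun h => Nat.find_min hex hi ⟨U', hU', h⟩
  refine ⟨d, hdl, U, hUθ, prod_range_le_indepMass hθ_nonneg growth, ?_⟩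
  change Module.finrank K U ≤ d at hU
  change massOff u w U ≤ θ d at hUθ
  rcases hd : d with _ | j
  · rw [hd] at hU
    rw [strayMass_zero hU, mul_zero]
    exact indepMass_nonneg hw 0
  · rw [hd] at hU hUθ
    calc 4 * strayMass u w (j + 1) U ≤ 4 * ((j + 1) * θ (j + 1) * indepMass K u w j) := by
          have hr := indepMass_nonneg (K := K) (u := u) hw j
          grw [strayMass_succ_le hw hU, hUθ]
      _ = 4 * (j + 1) * θ (j + 1) * indepMass K u w j := by ring
      _ ≤ θ j * indepMass K u w j :=
          mul_le_mul_of_nonneg_right (hθ j (by lia)) (indepMass_nonneg hw j)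
      _ ≤ indepMass K u w (j + 1) := growth j (by lia)

end Stray

variable {j : ℕ} {U : Submodule K V}

lemma spanMargin_compl (S : Set (Submodule K V)) : spanMargin u w j Sᶜ = -spanMargin u w j S := by
  rw [spanMargin, spanMargin, ← Finset.sum_neg_distrib]
  refine Finset.sum_congr rfl fun x _ => ?_
  by_cases h : tupleSpan K u x ∈ S <;> simp [h]

lemma sub_strayMass_le_spanMargin (hw : ∀ z, 0 ≤ w z) {S : Set (Submodule K V)} (hU : U ∈ S) :
    indepMass K u w j - 2 * strayMass u w j U ≤ spanMargin u w j S := by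
  rw [indepMass, strayMass, spanMargin, Finset.mul_sum, ← Finset.sum_sub_distrib]
  refine Finset.sum_le_sum fun x _ => ?_
  have hx := indepWeight_nonneg (K := K) (u := u) hw x
  by_cases hxU : tupleSpan K u x = U
  · simp [hxU, hU]
  · rw [if_neg hxU]
    split_ifs <;> linarith

lemma nonneg_iff_mem_of_abs_sub_spanMargin_le (hw : ∀ z, 0 ≤ w z) {τ a : ℝ}
    (hτ : τ < indepMass K u w j - 2 * strayMass u w j U) {S : Set (Submodule K V)}
    (ha : |a - spanMargin u w j S| ≤ τ) : 0 ≤ a ↔ U ∈ S := by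
  rw [abs_le] at ha
  refine ⟨fun h => ?_, fun hU => by linarith [sub_strayMass_le_spanMargin (u := u) (j := j) hw hU]⟩
  by_contra hU
  have := sub_strayMass_le_spanMargin (u := u) (j := j) hw (show U ∈ Sᶜ from hU)
  rw [spanMargin_compl] at this
  linarith

lemma decide_nonneg_eq_code (hw : ∀ z, 0 ≤ w z) {τ : ℝ}
    (hτ : τ < indepMass K u w j - 2 * strayMass u w j U) {ι : Type*} {e : Submodule K V → ι → Bool}
    {a : ι → ℝ} (ha : ∀ i, |a i - spanMargin u w j {U | e U i = true}| ≤ τ) :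
    (fun i => decide (0 ≤ a i)) = e U :=
  funext fun i => Bool.eq_iff_iff.2 <| decide_eq_true_iff.trans <|
    nonneg_iff_mem_of_abs_sub_spanMargin_le hw hτ (ha i)

lemma le_of_strayMass_lt (hw : ∀ z, 0 ≤ w z) {T : Submodule K V} (hT : massOff u w T = 0)
    (h : strayMass u w j U < indepMass K u w j) : U ≤ T := by
  classical
  have weight_eq_zero {z : Z} (hz : u z ∉ T) : w z = 0 := by
    have := (Fintype.sum_eq_zero_iff_of_nonneg fun z => by
      dsimp only [Pi.zero_apply]; split_ifs <;> simp [hw]).1 hT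
    simpa [hz] using congrFun this z
  contrapose! h
  refine Finset.sum_le_sum fun x _ => ?_
  split_ifs with hx
  · obtain ⟨i, hi⟩ : ∃ i, u (x i) ∉ T := by
      by_contra! hmem
      exact h (hx ▸ tupleSpan_le.2 hmem)
    rw [indepWeight, Finset.prod_eq_zero (Finset.mem_univ i) (weight_eq_zero hi), ite_self]
  · exact le_rfl

lemma exists_decodable_subspace [FiniteDimensional K V] (hw : ∀ z, 0 ≤ w z) {l : ℕ} [NeZero l]
    {ε : ℝ} (hε : 0 < ε) (hε1 : ε ≤ 1) {T : Submodule K V} (hT : Module.finrank K T ≤ l)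
    (hTw : massOff u w T = 0) :
    ∃ d ≤ l, ∃ U ≤ T, massOff u w U ≤ ε / 2 ∧
      (ε / (2 * (4 * l) ^ l)) ^ l / 2 ≤ indepMass K u w d - 2 * strayMass u w d U := by
  have hl : (1 : ℝ) ≤ l := by exact_mod_cast NeZero.one_le (n := l)
  let θ (i : ℕ) : ℝ := ε / (2 * (4 * l) ^ i)
  have hθ_pos (i : ℕ) : 0 < θ i := by positivity
  have hθ_anti : Antitone θ := fun i j hij => by
    dsimp only [θ]
    gcongr
    linarith
  have hθ_step (i : ℕ) (hi : i < l) : 4 * (i + 1) * θ (i + 1) ≤ θ i := by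
    have hil : (i : ℝ) + 1 ≤ l := by exact_mod_cast hi
    calc 4 * (i + 1) * θ (i + 1) ≤ 4 * l * θ (i + 1) := by grw [hil]
      _ = θ i := by dsimp only [θ]; rw [pow_succ]; field_simp
  obtain ⟨d, hdl, U, hUθ, hmass, hstray⟩ :=
    exists_dominant_subspace hw (fun i => (hθ_pos i).le) hθ_step hT (hTw.trans_le (hθ_pos l).le)
  have pow_le : θ l ^ l ≤ indepMass K u w d := by
    have hθ_le_one : θ l ≤ 1 := (hθ_anti l.zero_le).trans (by dsimp only [θ]; norm_num; linarith)
    calc θ l ^ l ≤ θ l ^ d := pow_le_pow_of_le_one (hθ_pos l).le hθ_le_one hdl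
      _ = ∏ _i ∈ Finset.range d, θ l := by simp
      _ ≤ ∏ i ∈ Finset.range d, θ i := Finset.prod_le_prod (fun i _ => (hθ_pos l).le)
          fun i hi => hθ_anti ((Finset.mem_range.1 hi).le.trans hdl)
      _ ≤ indepMass K u w d := hmass
  have mass_pos : 0 < indepMass K u w d := (pow_pos (hθ_pos l) l).trans_le pow_le
  refine ⟨d, hdl, U, le_of_strayMass_lt hw hTw (by linarith), ?_, ?_⟩
  · calc massOff u w U ≤ θ d := hUθ
      _ ≤ θ 0 := hθ_anti d.zero_le
      _ = ε / 2 := by simp [θ]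
  · change θ l ^ l / 2 ≤ _
    linarith

end IndependentTuples

section Learner

/-- A query on the first `j` of `k` examples. -/
def Query.castLE {X : Type} {j k : ℕ} (h : j ≤ k) (φ : Query j X) : Query k X :=
  fun x => φ (x ∘ Fin.castLE h)

variable {K V : Type*} {Z : Type} [DivisionRing K] [AddCommGroup V] [Module K V] (u : Z → V)

open Classical in
/-- The query that vanishes unless all examples are positive and their vectors are linearly
independent, in which case its sign tells whether their span belongs to `S`. -/
def spanQuery (j : ℕ) (S : Set (Submodule K V)) : Query j (Z × ℤˣ) := fun x =>
  if (∀ i, (x i).2 = 1) ∧ LinearIndependent K (u ∘ Prod.fst ∘ x) then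
    if tupleSpan K u (Prod.fst ∘ x) ∈ S then ⟨1, by norm_num⟩ else ⟨-1, by norm_num⟩
  else ⟨0, by norm_num⟩

/-- The probability weights of the positive examples. -/
def posWeight (P : PMF Z) (f : Z → ℤˣ) (z : Z) : ℝ :=
  if f z = 1 then (P z).toReal else 0

open Classical in
/-- The hypothesis whose positive points are those with a vector in `U`. -/
def subspaceHyp (U : Submodule K V) : Z → ℤˣ :=
  fun z => if u z ∈ U then 1 else -1

variable {u} {P : PMF Z} {f : Z → ℤˣ}

lemma posWeight_nonneg (z : Z) : 0 ≤ posWeight P f z := by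
  unfold posWeight
  split_ifs <;> simp

variable [Fintype Z]

lemma expect_labeled_spanQuery (j : ℕ) (S : Set (Submodule K V)) :
    expect (labeled P f) (fun x => (spanQuery u j S x : ℝ)) = spanMargin u (posWeight P f) j S := by
  rw [labeled, expect_map, expect, spanMargin]
  refine Finset.sum_congr rfl fun y _ => ?_
  have fst_comp : Prod.fst ∘ (fun z => (z, f z)) ∘ y = y := rfl
  by_cases hf : ∀ i, f (y i) = 1
  · by_cases hi : LinearIndependent K (u ∘ y) <;> by_cases hS : tupleSpan K u y ∈ S <;>
      simp [spanQuery, indepWeight, posWeight, fst_comp, hf, hi, hS]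
  · have weight_eq_zero : indepWeight K u (posWeight P f) y = 0 := by
      push Not at hf
      obtain ⟨i, hi⟩ := hf
      rw [indepWeight, Finset.prod_eq_zero (Finset.mem_univ i) (if_neg hi), ite_self]
    simp [spanQuery, fst_comp, hf, weight_eq_zero]

lemma massOff_posWeight_eq_zero {T : Submodule K V} (hf : ∀ z, f z = 1 ↔ u z ∈ T) :
    massOff u (posWeight P f) T = 0 :=
  Finset.sum_eq_zero fun z _ => by by_cases hz : u z ∈ T <;> simp [posWeight, hf, hz]

lemma err_subspaceHyp {T U : Submodule K V} (hf : ∀ z, f z = 1 ↔ u z ∈ T) (hU : U ≤ T) :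
    err P f (subspaceHyp u U) = massOff u (posWeight P f) U := by
  rw [err, Finset.sum_filter, massOff]
  refine Finset.sum_congr rfl fun z _ => ?_
  by_cases hz : u z ∈ U
  · simp [subspaceHyp, hz, (hf z).2 (hU hz)]
  · rcases Int.units_eq_one_or (f z) with h | h <;> simp [subspaceHyp, posWeight, hz, h]

lemma threshold_pow_le {l : ℕ} [NeZero l] {ε : ℝ} (hε : 0 < ε) (hε1 : ε ≤ 1) :
    (ε / (2 * (4 * l) ^ l)) ^ l ≤ ε / 2 := by
  have hl : (1 : ℝ) ≤ l := by exact_mod_cast NeZero.one_le (n := l)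
  have hle : ε / (2 * (4 * l) ^ l) ≤ ε / 2 := by
    have : (1 : ℝ) ≤ (4 * l) ^ l := one_le_pow₀ (by linarith)
    gcongr
    linarith
  exact (pow_le_of_le_one (by positivity) (by linarith) (NeZero.ne l)).trans hle

-- Ask for every bit of the codes of the spans of independent positive `d`-tuples, for each `d ≤ l`;
-- the answers for one good `d` spell out the code of a subspace of small error.
theorem detLearnable_of_subspaces [FiniteDimensional K V] {l : ℕ} [NeZero l] {ι : Type}
    [Fintype ι] {e : Submodule K V → ι → Bool} (he : Function.Injective e) {C : Set (Z → ℤˣ)}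
    (hC : ∀ f ∈ C, ∃ T : Submodule K V, Module.finrank K T ≤ l ∧ ∀ z, f z = 1 ↔ u z ∈ T)
    {ε τ : ℝ} (hε : 0 < ε) (hε1 : ε ≤ 1) (hτ : τ ≤ (ε / (2 * (4 * l) ^ l)) ^ l / 4) :
    DetLearnable l C ε τ ((l + 1) * (Fintype.card ι + 1)) := by
  let φ (c : Fin (l + 1) × ι) : Query l (Z × ℤˣ) :=
    Query.castLE (Nat.le_of_lt_succ c.1.2) (spanQuery u c.1 {U | e U c.2 = true})
  let h (a : Fin (l + 1) × ι → ℝ) (d : Fin (l + 1)) : Z → ℤˣ :=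
    subspaceHyp u (Function.invFun e fun i => decide (0 ≤ a (d, i)))
  have learn := detLearnable_of_candidates (C := C) (ε := ε) (τ := τ) φ h
  rw [Fintype.card_prod, Fintype.card_fin, ← mul_add_one] at learn
  refine learn fun P f hf a ha => ?_
  obtain ⟨T, hT, hfT⟩ := hC f hf
  obtain ⟨d, hdl, U, hUT, hUε, hUτ⟩ := exists_decodable_subspace
    (w := posWeight P f) posWeight_nonneg hε hε1 hT (massOff_posWeight_eq_zero hfT)
  let d' : Fin (l + 1) := ⟨d, Nat.lt_succ_of_le hdl⟩
  have hl : 0 < l := NeZero.pos l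
  have pow_pos : 0 < (ε / (2 * (4 * l) ^ l)) ^ l := by positivity
  have answer (i : ι) : |a (d', i) - spanMargin u (posWeight P f) d {U | e U i = true}| ≤ τ := by
    rw [← expect_labeled_spanQuery, ← expect_comp_castLE _ hdl]
    exact ha (d', i)
  refine ⟨d', ?_⟩
  change err P f (subspaceHyp u (Function.invFun e fun i => decide (0 ≤ a (d', i)))) + τ ≤ ε
  rw [decide_nonneg_eq_code posWeight_nonneg (by linarith) answer,
    Function.leftInverse_invFun he U, err_subspaceHyp hfT hUT]
  linarith [threshold_pow_le (l := l) hε hε1]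

end Learner

section UpperBound

lemma card_submodule_le (K V : Type*) [Field K] [AddCommGroup V] [Module K V] [Finite K]
    [FiniteDimensional K V] :
    Nat.card (Submodule K V) ≤ Nat.card K ^ Module.finrank K V ^ 2 := by
  have range_surjective :
      Function.Surjective (LinearMap.range : (V →ₗ[K] V) → Submodule K V) := fun U => by
    obtain ⟨g, hg⟩ := LinearMap.exists_leftInverse_of_injective U.subtype U.ker_subtype
    refine ⟨U.subtype ∘ₗ g, ?_⟩
    rw [LinearMap.range_comp, LinearMap.range_eq_top.2, Submodule.map_top, Submodule.range_subtype]
    exact fun y => ⟨y, LinearMap.congr_fun hg y⟩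
  have : Finite (V →ₗ[K] V) := Module.finite_of_finite K
  calc Nat.card (Submodule K V) ≤ Nat.card (V →ₗ[K] V) :=
        Nat.card_le_card_of_surjective _ range_surjective
    _ = Nat.card K ^ Module.finrank K V ^ 2 := by
        rw [Module.natCard_eq_pow_finrank (K := K), Module.finrank_linearMap, sq]

lemma exists_injective_bits {α : Type*} [Finite α] {N : ℕ} (h : Nat.card α ≤ 2 ^ N) :
    ∃ e : α → Fin N → Bool, Function.Injective e := by
  have := Fintype.ofFinite α
  obtain ⟨e⟩ := Function.Embedding.nonempty_of_card_le (α := α) (β := Fin N → Bool)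
    (by simpa [Nat.card_eq_fintype_card] using h)
  exact ⟨e, e.injective⟩

lemma mem_hyp_iff {p n : ℕ} {a z : Fin (n + 1) → ZMod p} :
    z ∈ hyp a ↔ z (Fin.last n) = Fin.init a ⬝ᵥ Fin.init z + a (Fin.last n) :=
  Iff.rfl

lemma hypFun_eq_one_iff {p n : ℕ} {a z : Fin (n + 1) → ZMod p} :
    hypFun a z = 1 ↔ z ∈ hyp a := by
  unfold hypFun
  split_ifs with h <;> simp [h]

-- In homogeneous coordinates `(z, 1)`, an affine hyperplane is cut out by a linear functional.
lemma exists_submodule_hypFun {p n : ℕ} [Fact p.Prime] (a : Fin (n + 1) → ZMod p) :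
    ∃ T : Submodule (ZMod p) ((Fin (n + 1) → ZMod p) × ZMod p),
      Module.finrank (ZMod p) T ≤ n + 1 ∧ ∀ z, hypFun a z = 1 ↔ (z, 1) ∈ T := by
  let φ : Module.Dual (ZMod p) ((Fin (n + 1) → ZMod p) × ZMod p) :=
    LinearMap.coprod
      (∑ i : Fin n, a i.castSucc • LinearMap.proj i.castSucc - LinearMap.proj (Fin.last n))
      (a (Fin.last n) • LinearMap.id)
  have hφ : φ ≠ 0 := fun h => by
    have := LinearMap.congr_fun h (Pi.single (Fin.last n) 1, 0)
    simp [φ, Fin.castSucc_ne_last] at this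
  refine ⟨LinearMap.ker φ, ?_, fun z => ?_⟩
  · have := Module.Dual.finrank_ker_add_one_of_ne_zero hφ
    simp only [Module.finrank_prod, Module.finrank_fin_fun, Module.finrank_self] at this
    lia
  · rw [hypFun_eq_one_iff, LinearMap.mem_ker, mem_hyp_iff, ← sub_eq_zero, ← neg_eq_zero]
    refine Eq.congr_left ?_
    simp only [φ, dotProduct, Fin.init, neg_sub, LinearMap.coprod_apply, LinearMap.sub_apply,
      LinearMap.sum_apply, LinearMap.smul_apply, LinearMap.coe_proj, Function.eval, smul_eq_mul,
      LinearMap.id_coe, id_eq, mul_one]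
    ring

lemma detLearnable_of_one_le {Z : Type} [Fintype Z] {k q : ℕ} {C : Set (Z → ℤˣ)} {ε τ : ℝ}
    (hε : 1 ≤ ε) : DetLearnable k C ε τ q :=
  ⟨.output fun _ => 1, fun _ _ _ _ _ => ⟨q.zero_le, (err_le_one _ _ _).trans hε⟩⟩

lemma detLearnable_hypClass {p k N : ℕ} [Fact p.Prime] (hN : p ^ (k + 2) ^ 2 ≤ 2 ^ N) {ε τ : ℝ}
    (hε : 0 < ε) (hε1 : ε ≤ 1)
    (hτ : τ ≤ (ε / (2 * (4 * (k + 1 : ℕ)) ^ (k + 1))) ^ (k + 1) / 4) :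
    DetLearnable (k + 1) (hypClass p k) ε τ ((k + 2) * (N + 1)) := by
  have hcard := card_submodule_le (ZMod p) ((Fin (k + 1) → ZMod p) × ZMod p)
  simp only [Module.finrank_prod, Module.finrank_fin_fun, Module.finrank_self, Nat.card_zmod]
    at hcard
  obtain ⟨e, he⟩ := exists_injective_bits (hcard.trans hN)
  have learn := detLearnable_of_subspaces (u := fun z => (z, 1)) (C := hypClass p k) he
    (by rintro _ ⟨a, rfl⟩; exact exists_submodule_hypFun a) hε hε1 hτ
  rwa [Fintype.card_fin] at learn

/-- The factor by which the bit length of `p` is multiplied to bound both the number of queries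
that learning `hypClass p k` takes and the inverse of their tolerance in units of `ε ^ (k + 1)`. -/
def hypQueries (k : ℕ) : ℕ :=
  (k + 2) * ((k + 2) ^ 2 + 1) + 4 * (2 * (4 * (k + 1)) ^ (k + 1)) ^ (k + 1)

theorem hypClass_upper_bound (k : ℕ) :
    ∃ c : ℝ, 0 < c ∧ ∀ (p : ℕ) [Fact p.Prime],
      ∃ t : ℕ, 1 ≤ t ∧ (t : ℝ) ≤ c * Real.log p ∧
        ∀ ε : ℝ, 0 < ε →
          DetLearnable (k + 1) (hypClass p k) ε (ε ^ (k + 1) / t) t := by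
  have : 0 < Real.log 2 := Real.log_pos one_lt_two
  have hc : 0 < hypQueries k := by unfold hypQueries; positivity
  refine ⟨hypQueries k * (2 / Real.log 2), by positivity, fun p hp => ?_⟩
  let L := Nat.log 2 p + 1
  have hL : 1 ≤ L := Nat.le_add_left 1 _
  have hpL : p < 2 ^ L := Nat.lt_pow_succ_log_self one_lt_two p
  refine ⟨hypQueries k * L, Nat.mul_pos hc hL, ?_, fun ε hε => ?_⟩
  · have hlog : 1 ≤ Nat.log 2 p := Nat.log_pos one_lt_two hp.out.two_le
    have hlogb : (Nat.log 2 p : ℝ) ≤ Real.log p / Real.log 2 := Real.natLog_le_logb p 2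
    have hL2 : (L : ℝ) ≤ 2 * Nat.log 2 p := by exact_mod_cast (by lia : L ≤ 2 * Nat.log 2 p)
    calc ((hypQueries k * L : ℕ) : ℝ) ≤ hypQueries k * (2 * (Real.log p / Real.log 2)) := by
          push_cast
          grw [hL2, hlogb]
      _ = _ := by ring
  rcases le_total 1 ε with hε1 | hε1
  · exact detLearnable_of_one_le hε1
  have bits : p ^ (k + 2) ^ 2 ≤ 2 ^ (L * (k + 2) ^ 2) := by
    rw [pow_mul]
    exact Nat.pow_le_pow_left hpL.le _
  have queries : (k + 2) * (L * (k + 2) ^ 2 + 1) ≤ hypQueries k * L := by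
    calc (k + 2) * (L * (k + 2) ^ 2 + 1) ≤ (k + 2) * (L * (k + 2) ^ 2 + L) := by gcongr
      _ = (k + 2) * ((k + 2) ^ 2 + 1) * L := by ring
      _ ≤ hypQueries k * L := by unfold hypQueries; gcongr; exact Nat.le_add_right _ _
  have tolerance : 4 * (2 * (4 * (k + 1)) ^ (k + 1)) ^ (k + 1) ≤ hypQueries k * L :=
    (Nat.le_add_left _ _).trans (Nat.le_mul_of_pos_right _ hL)
  refine (detLearnable_hypClass bits hε hε1 ?_).mono le_rfl le_rfl queries
  rw [div_pow, div_div, mul_comm _ (4 : ℝ)]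
  gcongr
  exact_mod_cast tolerance

end UpperBound

section Correlation

lemma sq_sum_abs_sum_mul_le {ι Y : Type*} [Fintype ι] [Fintype Y] (g : ι → Y → ℝ) {W φ : Y → ℝ}
    (hW : ∀ y, 0 < W y) (hW1 : ∑ y, W y = 1) (hφ : ∀ y, |φ y| ≤ 1) :
    (∑ i, |∑ y, g i y * φ y|) ^ 2 ≤ ∑ i, ∑ j, |∑ y, g i y * g j y / W y| := by
  let s (i : ι) : ℝ := SignType.sign (∑ y, g i y * φ y)
  have abs_s_le (i : ι) : |s i| ≤ 1 := by
    rcases hs : SignType.sign (∑ y, g i y * φ y) <;> simp [s, hs]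
  let G (y : Y) : ℝ := ∑ i, s i * g i y
  have sum_abs_eq : ∑ i, |∑ y, g i y * φ y| = ∑ y, G y * φ y := by
    simp_rw [G, Finset.sum_mul]
    rw [Finset.sum_comm]
    refine Finset.sum_congr rfl fun i _ => ?_
    rw [← sign_mul_self, Finset.mul_sum]
    exact Finset.sum_congr rfl fun y _ => (mul_assoc _ _ _).symm
  have sq_le (y : Y) : (G y * φ y) ^ 2 ≤ G y ^ 2 / W y * W y := by
    rw [div_mul_cancel₀ _ (hW y).ne', mul_pow]
    exact mul_le_of_le_one_right (sq_nonneg _) ((sq_le_one_iff_abs_le_one _).2 (hφ y))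
  calc (∑ i, |∑ y, g i y * φ y|) ^ 2 = (∑ y, G y * φ y) ^ 2 := by rw [sum_abs_eq]
    _ ≤ (∑ y, G y ^ 2 / W y) * ∑ y, W y :=
        Finset.sum_sq_le_sum_mul_sum_of_sq_le_mul _
          (fun y _ => div_nonneg (sq_nonneg _) (hW y).le) (fun y _ => (hW y).le) fun y _ => sq_le y
    _ = ∑ i, ∑ j, s i * s j * ∑ y, g i y * g j y / W y := by
        simp_rw [hW1, mul_one, G, sq, Finset.sum_mul_sum, Finset.sum_div, Finset.mul_sum]
        rw [Finset.sum_comm]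
        refine Finset.sum_congr rfl fun i _ => ?_
        rw [Finset.sum_comm]
        exact Finset.sum_congr rfl fun j _ => Finset.sum_congr rfl fun y _ => by ring
    _ ≤ ∑ i, ∑ j, |∑ y, g i y * g j y / W y| :=
        Finset.sum_le_sum fun i _ => Finset.sum_le_sum fun j _ => (le_abs_self _).trans <| by
          rw [abs_mul, abs_mul]
          exact mul_le_of_le_one_left (abs_nonneg _)
            (mul_le_one₀ (abs_s_le i) (abs_nonneg _) (abs_s_le j))

variable {X : Type} [Fintype X]

/-- The correlation `∑ x, D x * D' x / D₀ x` of two distributions relative to a reference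
distribution `D₀` of full support; it is `1` plus their covariance as densities. -/
def correlation (D₀ D D' : PMF X) : ℝ :=
  ∑ x, (D x).toReal * (D' x).toReal / (D₀ x).toReal

lemma sum_prod_toReal_eq_one (D : PMF X) (k : ℕ) :
    ∑ x : Fin k → X, ∏ i, (D (x i)).toReal = 1 :=
  (Fintype.sum_pow (fun x => (D x).toReal) k).symm.trans (by rw [sum_toReal_eq_one, one_pow])

variable {D₀ : PMF X}

lemma sum_prod_sub_mul_div_eq (hD₀ : ∀ x, 0 < (D₀ x).toReal) (k : ℕ) (D D' : PMF X) :
    ∑ x : Fin k → X, (∏ i, (D (x i)).toReal - ∏ i, (D₀ (x i)).toReal) *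
      (∏ i, (D' (x i)).toReal - ∏ i, (D₀ (x i)).toReal) / ∏ i, (D₀ (x i)).toReal =
      correlation D₀ D D' ^ k - 1 := by
  have term_eq (x : Fin k → X) : (∏ i, (D (x i)).toReal - ∏ i, (D₀ (x i)).toReal) *
      (∏ i, (D' (x i)).toReal - ∏ i, (D₀ (x i)).toReal) / ∏ i, (D₀ (x i)).toReal =
      ∏ i, ((D (x i)).toReal * (D' (x i)).toReal / (D₀ (x i)).toReal) -
        ∏ i, (D (x i)).toReal - ∏ i, (D' (x i)).toReal + ∏ i, (D₀ (x i)).toReal := by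
    have : ∏ i, (D₀ (x i)).toReal ≠ 0 := (Finset.prod_pos fun i _ => hD₀ (x i)).ne'
    rw [Finset.prod_div_distrib, Finset.prod_mul_distrib]
    field_simp
    ring
  simp_rw [term_eq, Finset.sum_add_distrib, Finset.sum_sub_distrib, sum_prod_toReal_eq_one,
    correlation, Fintype.sum_pow]
  ring

variable {ι : Type*} [Fintype ι]

lemma sq_sum_abs_expect_sub_le (hD₀ : ∀ x, 0 < (D₀ x).toReal) (D : ι → PMF X) {k : ℕ}
    (φ : Query k X) :
    (∑ i, |expect (D i) (fun x => (φ x : ℝ)) - expect D₀ (fun x => (φ x : ℝ))|) ^ 2 ≤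
      ∑ i, ∑ j, |correlation D₀ (D i) (D j) ^ k - 1| := by
  have h := sq_sum_abs_sum_mul_le
    (fun (i : ι) (x : Fin k → X) => ∏ m, (D i (x m)).toReal - ∏ m, (D₀ (x m)).toReal)
    (W := fun x => ∏ m, (D₀ (x m)).toReal) (φ := fun x => (φ x : ℝ))
    (fun x => Finset.prod_pos fun m _ => hD₀ (x m))
    (sum_prod_toReal_eq_one D₀ k) fun x => abs_le.2 (φ x).2
  simp only [sum_prod_sub_mul_div_eq hD₀] at h
  simpa only [expect, sub_mul, Finset.sum_sub_distrib] using h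

open Classical in
/-- The indices `i` whose distribution `D i` a query with tolerance `τ` distinguishes from `D₀`. -/
def distinguished (D₀ : PMF X) (D : ι → PMF X) (τ : ℝ) {k : ℕ} (φ : Query k X) : Finset ι :=
  {i | τ < |expect (D i) (fun x => (φ x : ℝ)) - expect D₀ (fun x => (φ x : ℝ))|}

lemma card_distinguished_mul_le (hD₀ : ∀ x, 0 < (D₀ x).toReal) {D : ι → PMF X} (τ : ℝ) {k : ℕ}
    {M : ℝ} (hM : ∑ i, ∑ j, |correlation D₀ (D i) (D j) ^ k - 1| ≤ M) (φ : Query k X) :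
    (distinguished D₀ D τ φ).card * τ ≤ √M := by
  let dev (i : ι) : ℝ := |expect (D i) (fun x => (φ x : ℝ)) - expect D₀ (fun x => (φ x : ℝ))|
  calc (distinguished D₀ D τ φ).card * τ ≤ ∑ i ∈ distinguished D₀ D τ φ, dev i := by
        rw [← nsmul_eq_mul]
        exact Finset.card_nsmul_le_sum _ _ _ fun i hi => (Finset.mem_filter.1 hi).2.le
    _ ≤ ∑ i, dev i :=
        Finset.sum_le_sum_of_subset_of_nonneg (Finset.subset_univ _) fun _ _ _ => abs_nonneg _
    _ ≤ √M := Real.le_sqrt_of_sq_le ((sq_sum_abs_expect_sub_le hD₀ D φ).trans hM)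

end Correlation

section Adversary

-- The algorithm follows the path of the reference answers `O₀`, cut off after `q` queries.
lemma SQAlg.exists_transcript {k : ℕ} {X H : Type} (O₀ : Query k X → ℝ) (q : ℕ)
    (A : SQAlg k X H) :
    ∃ (l : List (Query k X)) (h : H), l.length ≤ q ∧ ∀ O : Query k X → ℝ,
      (∀ φ ∈ l, O φ = O₀ φ) → A.numQueries O ≤ q → A.run O = h := by
  induction q generalizing A with
  | zero =>
    refine ⟨[], A.run O₀, le_rfl, fun O _ hO => ?_⟩
    cases A with
    | output h => rfl
    | query φ next => exact absurd hO (Nat.not_succ_le_zero _)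
  | succ q ih =>
    cases A with
    | output h => exact ⟨[], h, Nat.zero_le _, fun _ _ _ => rfl⟩
    | query φ next =>
      obtain ⟨l, h, hl, hrun⟩ := ih (next (O₀ φ))
      refine ⟨φ :: l, h, Nat.succ_le_succ hl, fun O hO hq => ?_⟩
      have hφ : O φ = O₀ φ := hO φ List.mem_cons_self
      rw [SQAlg.numQueries, hφ] at hq
      rw [SQAlg.run, hφ]
      exact hrun O (fun ψ hψ => hO ψ (List.mem_cons_of_mem _ hψ)) (Nat.le_of_succ_le_succ hq)

open Classical in
/-- The oracle for `D` that answers as for `D₀` whenever the tolerance `τ` permits. -/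
def adversary {X : Type} [Fintype X] {k : ℕ} (D₀ D : PMF X) (τ : ℝ) (φ : Query k X) : ℝ :=
  if |expect D (fun x => (φ x : ℝ)) - expect D₀ (fun x => (φ x : ℝ))| ≤ τ then
    expect D₀ (fun x => (φ x : ℝ))
  else expect D (fun x => (φ x : ℝ))

lemma isSTAT_adversary {X : Type} [Fintype X] {k : ℕ} (D₀ D : PMF X) {τ : ℝ} (hτ : 0 ≤ τ) :
    IsSTAT D τ (adversary (k := k) D₀ D τ) := fun φ => by
  unfold adversary
  split_ifs with h
  · rwa [abs_sub_comm]
  · simpa using hτ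

lemma le_sum_measure_of_forall_le_card {Ω ι : Type*} [Fintype ι] [MeasurableSpace Ω]
    (μ : MeasureTheory.Measure Ω) [MeasureTheory.IsProbabilityMeasure μ] {F : ι → Set Ω}
    [∀ ω, DecidablePred fun i => ω ∈ F i] {M : ℝ≥0∞}
    (hM : ∀ ω, M ≤ ({i | ω ∈ F i} : Finset ι).card) : M ≤ ∑ i, μ (F i) := by
  let E (i : ι) : Set Ω := MeasureTheory.toMeasurable μ (F i)
  have hE (i : ι) : MeasurableSet (E i) := MeasureTheory.measurableSet_toMeasurable μ _
  calc M = ∫⁻ _, M ∂μ := by simp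
    _ ≤ ∫⁻ ω, ∑ i, (E i).indicator 1 ω ∂μ := by
      refine MeasureTheory.lintegral_mono fun ω => (hM ω).trans ?_
      rw [Finset.card_filter, Nat.cast_sum]
      refine Finset.sum_le_sum fun i _ => ?_
      by_cases hi : ω ∈ F i
      · simp [hi, E, MeasureTheory.subset_toMeasurable μ _ hi]
      · simp [hi]
    _ = ∑ i, μ (F i) := by
      rw [MeasureTheory.lintegral_finsetSum _ fun i _ => measurable_one.indicator (hE i)]
      simp_rw [MeasureTheory.lintegral_indicator_one (hE _), E,
        MeasureTheory.measure_toMeasurable]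

variable {Z : Type} [Fintype Z] {D₀ : PMF (Z × ℤˣ)} {ε τ : ℝ} {k q : ℕ} [NeZero k]

lemma expect_corrQuery_eq_zero (hsymm : ∀ z, D₀ (z, 1) = D₀ (z, -1)) (h : Z → ℤˣ) :
    expect D₀ (fun x => (corrQuery k h x : ℝ)) = 0 := by
  refine (expect_apply_zero (k := k) D₀ fun x => (((x.2 * h x.1 : ℤˣ) : ℤ) : ℝ)).trans ?_
  rw [Fintype.sum_prod_type]
  exact Finset.sum_eq_zero fun z _ => by simp [hsymm]

variable {ι : Type*} [Fintype ι] {P : ι → PMF Z} {f : ι → Z → ℤˣ}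

open Classical in
lemma card_err_le_le_mul (hsymm : ∀ z, D₀ (z, 1) = D₀ (z, -1)) (hε : 2 * ε < 1 - τ) {B : ℝ}
    (hB : ∀ φ : Query k (Z × ℤˣ),
      ((distinguished D₀ (fun i => labeled (P i) (f i)) τ φ).card : ℝ) ≤ B)
    {A : SQAlg k (Z × ℤˣ) (Z → ℤˣ)}
    (hA : ∀ i, A.numQueries (adversary D₀ (labeled (P i) (f i)) τ) ≤ q) :
    (({i | err (P i) (f i) (A.run (adversary D₀ (labeled (P i) (f i)) τ)) ≤ ε} :
      Finset ι).card : ℝ) ≤ (q + 1) * B := by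
  let O (i : ι) : Query k (Z × ℤˣ) → ℝ := adversary D₀ (labeled (P i) (f i)) τ
  let Dist := distinguished D₀ (fun i => labeled (P i) (f i)) τ (k := k)
  obtain ⟨l, h, hl, hrun⟩ := A.exists_transcript (fun φ => expect D₀ fun x => (φ x : ℝ)) q
  let tests : Finset (Query k (Z × ℤˣ)) := insert (corrQuery k h) l.toFinset
  have cover : ({i | err (P i) (f i) (A.run (O i)) ≤ ε} : Finset ι) ⊆ tests.biUnion Dist := by
    intro i hi
    by_contra hmem
    have close (φ) (hφ : φ ∈ tests) : |expect (labeled (P i) (f i)) (fun x => (φ x : ℝ)) -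
        expect D₀ (fun x => (φ x : ℝ))| ≤ τ := by
      by_contra! hlt
      exact hmem (Finset.mem_biUnion.2 ⟨φ, hφ, Finset.mem_filter.2 ⟨Finset.mem_univ i, hlt⟩⟩)
    have run_eq : A.run (O i) = h :=
      hrun _ (fun φ hφ => if_pos (close φ (by simp [tests, hφ]))) (hA i)
    have herr := (Finset.mem_filter.1 hi).2
    have hcorr := close _ (Finset.mem_insert_self _ _)
    rw [run_eq] at herr
    rw [expect_labeled_corrQuery, expect_corrQuery_eq_zero hsymm, sub_zero] at hcorr
    linarith [(abs_le.1 hcorr).2]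
  have card_tests : (tests.card : ℝ) ≤ q + 1 := by
    exact_mod_cast (Finset.card_insert_le _ _).trans
      (Nat.succ_le_succ ((List.toFinset_card_le l).trans hl))
  have hB0 : 0 ≤ B := (Nat.cast_nonneg _).trans (hB (corrQuery k h))
  calc _ ≤ ((tests.biUnion Dist).card : ℝ) := by exact_mod_cast Finset.card_le_card cover
    _ ≤ ∑ φ ∈ tests, ((Dist φ).card : ℝ) := by exact_mod_cast Finset.card_biUnion_le
    _ ≤ tests.card * B := by
        rw [← nsmul_eq_mul]
        exact Finset.sum_le_card_nsmul _ _ _ fun φ _ => hB φ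
    _ ≤ (q + 1) * B := by gcongr

theorem RandLearnable.mul_card_le {C : Set (Z → ℤˣ)} {δ : ℝ} (hC : RandLearnable k C ε δ τ q)
    (hδ : 0 ≤ δ) (hτ : 0 < τ) (hε : 2 * ε < 1 - τ) (hD₀ : ∀ x, 0 < (D₀ x).toReal)
    (hsymm : ∀ z, D₀ (z, 1) = D₀ (z, -1)) (hf : ∀ i, f i ∈ C) {M : ℝ}
    (hM : ∑ i, ∑ j, |correlation D₀ (labeled (P i) (f i)) (labeled (P j) (f j)) ^ k - 1| ≤ M) :
    (1 - δ) * Fintype.card ι * τ ≤ (q + 1) * √M := by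
  classical
  obtain ⟨Ω, _, μ, _, A, hA⟩ := hC
  let O (i : ι) : Query k (Z × ℤˣ) → ℝ := adversary D₀ (labeled (P i) (f i)) τ
  replace hA (i : ι) := hA (P i) (f i) (hf i) (O i) (isSTAT_adversary _ _ hτ.le)
  let F (i : ι) : Set Ω := {ω | ε < err (P i) (f i) ((A ω).run (O i))}
  have hB (φ : Query k (Z × ℤˣ)) :
      ((distinguished D₀ (fun i => labeled (P i) (f i)) τ φ).card : ℝ) ≤ √M / τ :=
    (le_div_iff₀ hτ).2 (card_distinguished_mul_le hD₀ τ hM φ)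
  have failures (ω : Ω) : Fintype.card ι - (q + 1) * (√M / τ) ≤
      (({i | ω ∈ F i} : Finset ι).card : ℝ) := by
    have successes := card_err_le_le_mul hsymm hε hB fun i => (hA i).1 ω
    have split : (({i | ω ∈ F i} : Finset ι).card : ℝ) +
        ({i | err (P i) (f i) ((A ω).run (O i)) ≤ ε} : Finset ι).card = Fintype.card ι := by
      simpa [F] using congrArg (Nat.cast (R := ℝ)) <|
        Finset.card_filter_add_card_filter_not (s := Finset.univ) fun i => ω ∈ F i
    linarith
  have average : Fintype.card ι - (q + 1) * (√M / τ) ≤ Fintype.card ι * δ := by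
    refine (ENNReal.ofReal_le_ofReal_iff (by positivity)).1 ?_
    calc ENNReal.ofReal (Fintype.card ι - (q + 1) * (√M / τ)) ≤ ∑ i, μ (F i) :=
          le_sum_measure_of_forall_le_card μ fun ω =>
            (ENNReal.ofReal_le_ofReal (failures ω)).trans_eq (ENNReal.ofReal_natCast _)
      _ ≤ ∑ _i : ι, ENNReal.ofReal δ := Finset.sum_le_sum fun i _ => (hA i).2
      _ = ENNReal.ofReal (Fintype.card ι * δ) := by
          rw [Finset.sum_const, Finset.card_univ, nsmul_eq_mul,
            ENNReal.ofReal_mul (Nat.cast_nonneg _), ENNReal.ofReal_natCast]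
  calc (1 - δ) * Fintype.card ι * τ ≤ (q + 1) * (√M / τ) * τ :=
        mul_le_mul_of_nonneg_right (by linarith) hτ.le
    _ = (q + 1) * √M := by field_simp

end Adversary

section Correlations

variable {Z : Type} [Fintype Z]

/-- The distribution giving mass `1 / 2` to each of the two fibres of `f`, uniformly on each: the
distribution on which the labels of `f` are hardest to correlate with. -/
def balancedDist (f : Z → ℤˣ) (hf : Function.Surjective f) : PMF Z :=
  (PMF.uniformOfFintype ℤˣ).bind fun b =>
    PMF.uniformOfFinset {z | f z = b} (by simpa [Finset.Nonempty] using hf b)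

variable {f g : Z → ℤˣ} (hf : Function.Surjective f) (hg : Function.Surjective g)

lemma toReal_labeled_balancedDist (x : Z × ℤˣ) :
    (labeled (balancedDist f hf) f x).toReal =
      if f x.1 = x.2 then (2 * (({z | f z = x.2} : Finset Z).card : ℝ))⁻¹ else 0 := by
  classical
  have balanced_apply (z : Z) : (balancedDist f hf z).toReal =
      (2 * (({y | f y = f z} : Finset Z).card : ℝ))⁻¹ := by
    rw [balancedDist, PMF.bind_apply, tsum_fintype, Finset.sum_eq_single (f z)
      (fun b _ hb => by rw [PMF.uniformOfFinset_apply, if_neg (by simp [hb.symm]), mul_zero])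
      (fun h => absurd (Finset.mem_univ _) h)]
    simp [PMF.uniformOfFinset_apply, mul_comm]
  simp_rw [labeled, toReal_map_apply, balanced_apply, Prod.ext_iff]
  rw [Finset.sum_eq_single x.1 (fun z _ hz => if_neg fun h => hz h.1.symm) (by simp)]
  split_ifs <;> simp_all

lemma correlation_labeled_balancedDist [Nonempty Z] :
    correlation (PMF.uniformOfFintype (Z × ℤˣ)) (labeled (balancedDist f hf) f)
      (labeled (balancedDist g hg) g) =
      Fintype.card Z / 2 * ∑ b : ℤˣ, (({z | f z = b ∧ g z = b} : Finset Z).card : ℝ) /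
        (({z | f z = b} : Finset Z).card * ({z | g z = b} : Finset Z).card) := by
  rw [correlation, Fintype.sum_prod_type_right, Finset.mul_sum]
  refine Finset.sum_congr rfl fun b _ => ?_
  rw [Finset.card_filter, Nat.cast_sum, Finset.sum_div, Finset.mul_sum]
  refine Finset.sum_congr rfl fun z _ => ?_
  simp only [toReal_labeled_balancedDist, PMF.uniformOfFintype_apply, Fintype.card_prod,
    Fintype.card_units_int]
  split_ifs <;> simp_all
  field_simp

lemma card_filter_neg_one_and_neg_one (f g : Z → ℤˣ) :
    (({z | f z = -1 ∧ g z = -1} : Finset Z).card : ℝ) =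
      Fintype.card Z - ({z | f z = 1} : Finset Z).card - ({z | g z = 1} : Finset Z).card +
        ({z | f z = 1 ∧ g z = 1} : Finset Z).card := by
  simp only [Finset.card_filter, Nat.cast_sum, Fintype.card_eq_sum_ones,
    ← Finset.sum_sub_distrib, ← Finset.sum_add_distrib]
  refine Finset.sum_congr rfl fun z _ => ?_
  rcases Int.units_eq_one_or (f z) with hf | hf <;>
    rcases Int.units_eq_one_or (g z) with hg | hg <;> simp [hf, hg]

end Correlations

section Hyperplanes

lemma card_mul_card_dotProduct_eq {K ι : Type*} [DivisionRing K] [Fintype K] [DecidableEq K]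
    [Fintype ι] [DecidableEq ι] {v : ι → K} (hv : v ≠ 0) (c : K) :
    Fintype.card K * ({y | v ⬝ᵥ y = c} : Finset (ι → K)).card =
      Fintype.card K ^ Fintype.card ι := by
  obtain ⟨i, hi⟩ := Function.ne_iff.1 hv
  let φ : (ι → K) →+ K := AddMonoidHom.mk' (fun y => v ⬝ᵥ y) fun y y' => dotProduct_add v y y'
  have range_eq (s : K) : s ∈ Set.range φ :=
    ⟨Pi.single i ((v i)⁻¹ * s), by simp [φ, mul_inv_cancel_left₀ hi]⟩
  calc Fintype.card K * ({y | v ⬝ᵥ y = c} : Finset (ι → K)).card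
      = ∑ s, ({y | φ y = s} : Finset (ι → K)).card := by
        rw [Finset.sum_congr rfl fun s _ =>
          AddMonoidHom.card_fiber_eq_of_mem_range φ (range_eq s) (range_eq c)]
        simp [φ]
    _ = Fintype.card K ^ Fintype.card ι := by
        rw [← Finset.card_eq_sum_card_fiberwise fun _ _ => Finset.mem_coe.2 (Finset.mem_univ _),
          Finset.card_univ, Fintype.card_fun]

variable {p n : ℕ} [Fact p.Prime]

lemma card_hyp_inter (a a' : Fin (n + 1) → ZMod p) :
    ({z | hypFun a z = 1 ∧ hypFun a' z = 1} : Finset (Fin (n + 1) → ZMod p)).card =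
      ({y | (Fin.init a - Fin.init a') ⬝ᵥ y = a' (Fin.last n) - a (Fin.last n)} :
        Finset (Fin n → ZMod p)).card := by
  refine Finset.card_nbij' Fin.init (fun y => Fin.snoc y (Fin.init a ⬝ᵥ y + a (Fin.last n)))
    (fun z hz => ?_) (fun y hy => ?_) (fun z hz => ?_) fun _ _ => Fin.init_snoc _ _
  · simp only [hypFun_eq_one_iff, mem_hyp_iff, Finset.coe_filter, Finset.mem_univ, true_and,
      Set.mem_ofPred_eq] at hz ⊢
    rw [sub_dotProduct, sub_eq_sub_iff_add_eq_add, add_comm (a' _), ← hz.1, ← hz.2]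
  · simp only [hypFun_eq_one_iff, mem_hyp_iff, Finset.coe_filter, Finset.mem_univ, true_and,
      Set.mem_ofPred_eq, Fin.init_snoc, Fin.snoc_last] at hy ⊢
    rwa [sub_dotProduct, sub_eq_sub_iff_add_eq_add, add_comm (a' _)] at hy
  · simp only [hypFun_eq_one_iff, mem_hyp_iff, Finset.coe_filter, Finset.mem_univ, true_and,
      Set.mem_ofPred_eq] at hz
    simp only [← hz.1, Fin.snoc_init_self]

/-- The fraction of the points of `hyp a` that lie in `hyp a'`. -/
def overlap (a a' : Fin (n + 1) → ZMod p) : ℝ :=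
  ({z | hypFun a z = 1 ∧ hypFun a' z = 1} : Finset (Fin (n + 1) → ZMod p)).card / (p : ℝ) ^ n

lemma overlap_self (a : Fin (n + 1) → ZMod p) : overlap a a = 1 := by
  have : (p : ℝ) ≠ 0 := by simp [NeZero.ne]
  rw [overlap, card_hyp_inter]
  simp [ZMod.card, this]

lemma overlap_of_init_eq {a a' : Fin (n + 1) → ZMod p} (h : Fin.init a = Fin.init a')
    (hne : a ≠ a') : overlap a a' = 0 := by
  have last_ne : a' (Fin.last n) - a (Fin.last n) ≠ 0 := fun h0 =>
    hne (by rw [← Fin.snoc_init_self a, ← Fin.snoc_init_self a', h, sub_eq_zero.1 h0])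
  simp [overlap, card_hyp_inter, h, last_ne.symm]

lemma overlap_of_init_ne {a a' : Fin (n + 1) → ZMod p} (h : Fin.init a ≠ Fin.init a') :
    overlap a a' = (p : ℝ)⁻¹ := by
  have hp : (p : ℝ) ≠ 0 := by simp [NeZero.ne]
  have hcard := congrArg (Nat.cast (R := ℝ)) <|
    card_mul_card_dotProduct_eq (sub_ne_zero.2 h) (a' (Fin.last n) - a (Fin.last n))
  simp only [ZMod.card, Fintype.card_fin] at hcard
  push_cast at hcard
  rw [overlap, card_hyp_inter, ← hcard]
  have := right_ne_zero_of_mul (hcard.trans_ne (pow_ne_zero n hp))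
  field_simp

lemma card_hypFun_eq_one (a : Fin (n + 1) → ZMod p) :
    (({z | hypFun a z = 1} : Finset (Fin (n + 1) → ZMod p)).card : ℝ) = (p : ℝ) ^ n := by
  have h := overlap_self a
  simp only [overlap, and_self] at h
  exact eq_of_div_eq_one h

lemma card_hypFun_eq_neg_one (a : Fin (n + 1) → ZMod p) :
    (({z | hypFun a z = -1} : Finset (Fin (n + 1) → ZMod p)).card : ℝ) =
      (p : ℝ) ^ n * (p - 1) := by
  have h := card_filter_neg_one_and_neg_one (hypFun a) (hypFun a)
  simp only [and_self, card_hypFun_eq_one, Fintype.card_fun, ZMod.card, Fintype.card_fin,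
    Nat.cast_pow] at h
  rw [h]
  ring

lemma hypFun_surjective (a : Fin (n + 1) → ZMod p) : Function.Surjective (hypFun a) := by
  have hp : (1 : ℝ) < p := by exact_mod_cast (Fact.out : p.Prime).one_lt
  have card_pos (b : ℤˣ) :
      (0 : ℝ) < ({z | hypFun a z = b} : Finset (Fin (n + 1) → ZMod p)).card := by
    rcases Int.units_eq_one_or b with rfl | rfl
    · rw [card_hypFun_eq_one]; positivity
    · rw [card_hypFun_eq_neg_one]
      exact mul_pos (by positivity) (sub_pos.2 hp)
  intro b
  obtain ⟨z, hz⟩ := Finset.card_pos.1 (Nat.cast_pos.1 (card_pos b))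
  exact ⟨z, (Finset.mem_filter.1 hz).2⟩

/-- The marginal distribution on which `hypFun a` is hard to learn. -/
def hypDist (a : Fin (n + 1) → ZMod p) : PMF (Fin (n + 1) → ZMod p) :=
  balancedDist (hypFun a) (hypFun_surjective a)

/-- The correlation, relative to uniform labeled examples, of the hard distributions of examples
labeled by `hypFun a` and by `hypFun a'`. -/
def hypCorrelation (a a' : Fin (n + 1) → ZMod p) : ℝ :=
  correlation (PMF.uniformOfFintype ((Fin (n + 1) → ZMod p) × ℤˣ))
    (labeled (hypDist a) (hypFun a)) (labeled (hypDist a') (hypFun a'))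

lemma hypCorrelation_eq (a a' : Fin (n + 1) → ZMod p) :
    hypCorrelation a a' = p / 2 * (overlap a a' + (p - 2 + overlap a a') / (p - 1) ^ 2) := by
  have hp : (1 : ℝ) < p := by exact_mod_cast (Fact.out : p.Prime).one_lt
  have hp' : (p : ℝ) - 1 ≠ 0 := (sub_pos.2 hp).ne'
  rw [hypCorrelation, hypDist, hypDist, correlation_labeled_balancedDist, UnitsInt.univ,
    Finset.sum_pair (by decide), card_filter_neg_one_and_neg_one]
  simp only [card_hypFun_eq_one, card_hypFun_eq_neg_one, overlap, Fintype.card_fun, ZMod.card,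
    Fintype.card_fin, Nat.cast_pow]
  field_simp
  ring

lemma hypCorrelation_self_mem_Icc (a : Fin (n + 1) → ZMod p) :
    hypCorrelation a a ∈ Set.Icc 0 (p : ℝ) := by
  have hp : (2 : ℝ) ≤ p := by exact_mod_cast (Fact.out : p.Prime).two_le
  have hp1 : 0 < (p : ℝ) - 1 := by linarith
  have corr_eq : hypCorrelation a a = (p : ℝ) ^ 2 / (2 * (p - 1)) := by
    rw [hypCorrelation_eq, overlap_self]
    field_simp
    ring
  rw [corr_eq]
  exact ⟨by positivity, (div_le_iff₀ (by positivity)).2 (by nlinarith)⟩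

lemma hypCorrelation_mem_Icc_of_init_eq {a a' : Fin (n + 1) → ZMod p}
    (h : Fin.init a = Fin.init a') (hne : a ≠ a') :
    hypCorrelation a a' ∈ Set.Icc (0 : ℝ) 1 := by
  have hp : (2 : ℝ) ≤ p := by exact_mod_cast (Fact.out : p.Prime).two_le
  have hp1 : 0 < (p : ℝ) - 1 := by linarith
  have : 0 ≤ (p : ℝ) - 2 := sub_nonneg.2 hp
  rw [hypCorrelation_eq, overlap_of_init_eq h hne, zero_add, add_zero]
  refine ⟨by positivity, ?_⟩
  field_simp
  nlinarith

lemma hypCorrelation_of_init_ne {a a' : Fin (n + 1) → ZMod p} (h : Fin.init a ≠ Fin.init a') :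
    hypCorrelation a a' = 1 := by
  have hp : (1 : ℝ) < p := by exact_mod_cast (Fact.out : p.Prime).one_lt
  have hp1 : 0 < (p : ℝ) - 1 := sub_pos.2 hp
  rw [hypCorrelation_eq, overlap_of_init_ne h]
  field_simp
  ring

lemma abs_hypCorrelation_pow_sub_one_le (a a' : Fin (n + 1) → ZMod p) (k : ℕ) :
    |hypCorrelation a a' ^ k - 1| ≤
      (if a = a' then (p : ℝ) ^ k else 0) + if Fin.init a = Fin.init a' then 1 else 0 := by
  by_cases hinit : Fin.init a = Fin.init a'
  · rw [if_pos hinit, abs_le]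
    by_cases haa : a = a'
    · subst haa
      obtain ⟨nonneg, le⟩ := hypCorrelation_self_mem_Icc a
      have := pow_nonneg nonneg k
      have := pow_le_pow_left₀ nonneg le k
      rw [if_pos rfl]
      constructor <;> linarith
    · obtain ⟨nonneg, le_one⟩ := hypCorrelation_mem_Icc_of_init_eq hinit haa
      have := pow_nonneg nonneg k
      have := pow_le_one₀ nonneg le_one (n := k)
      rw [if_neg haa]
      constructor <;> linarith
  · rw [if_neg (ne_of_apply_ne Fin.init hinit), if_neg hinit, hypCorrelation_of_init_ne hinit]
    simp

lemma sum_abs_hypCorrelation_pow_sub_one_le (p n k : ℕ) [Fact p.Prime] [NeZero k] :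
    ∑ a : Fin (n + 1) → ZMod p, ∑ a' : Fin (n + 1) → ZMod p, |hypCorrelation a a' ^ k - 1| ≤
      2 * (p : ℝ) ^ (n + 1 + k) := by
  have row (a : Fin (n + 1) → ZMod p) : ∑ a' : Fin (n + 1) → ZMod p,
      ((if a = a' then (p : ℝ) ^ k else 0) + if Fin.init a = Fin.init a' then 1 else 0) ≤
      2 * (p : ℝ) ^ k := by
    have parallel : ∑ a' : Fin (n + 1) → ZMod p,
        (if Fin.init a = Fin.init a' then (1 : ℝ) else 0) = p := by
      rw [← (Fin.snocEquiv fun _ => ZMod p).sum_comp, Fintype.sum_prod_type_right]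
      simp [Fin.snocEquiv, ZMod.card]
    have hp : (p : ℝ) ≤ p ^ k :=
      le_self_pow₀ (by exact_mod_cast (Fact.out : p.Prime).one_le) (NeZero.ne k)
    rw [Finset.sum_add_distrib, Finset.sum_ite_eq, if_pos (Finset.mem_univ _), parallel]
    linarith
  calc _ ≤ ∑ _a : Fin (n + 1) → ZMod p, 2 * (p : ℝ) ^ k :=
        Finset.sum_le_sum fun a _ => (Finset.sum_le_sum fun a' _ =>
          abs_hypCorrelation_pow_sub_one_le a a' k).trans (row a)
    _ = 2 * (p : ℝ) ^ (n + 1 + k) := by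
        simp only [Finset.sum_const, Finset.card_univ, Fintype.card_fun, ZMod.card,
          Fintype.card_fin, nsmul_eq_mul, Nat.cast_pow]
        ring

lemma RandLearnable.hypClass_mul_card_le {k q : ℕ} [NeZero k] {ε δ τ : ℝ}
    (h : RandLearnable k (hypClass p n) ε δ τ q) (hδ : 0 ≤ δ) (hτ : 0 < τ) (hε : 2 * ε < 1 - τ) :
    (1 - δ) * (p : ℝ) ^ (n + 1) * τ ≤ (q + 1) * √(2 * (p : ℝ) ^ (n + 1 + k)) := by
  have := h.mul_card_le hδ hτ hε (D₀ := PMF.uniformOfFintype _)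
    (fun x => ENNReal.toReal_pos (PMF.mem_support_uniformOfFintype x) (PMF.apply_ne_top _ x))
    (by simp)
    (fun a => Set.mem_range_self a) (sum_abs_hypCorrelation_pow_sub_one_le p n k)
  simpa [ZMod.card] using this

end Hyperplanes

section LowerBound

lemma not_randLearnable_of_neg {Z : Type} [Fintype Z] [Nonempty Z] {C : Set (Z → ℤˣ)}
    (hC : C.Nonempty) {k q : ℕ} {ε δ τ : ℝ} (hε : ε < 0) (hδ : δ < 1) (hτ : 0 ≤ τ) :
    ¬ RandLearnable k C ε δ τ q := by
  rintro ⟨Ω, _, μ, _, A, hA⟩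
  obtain ⟨f, hf⟩ := hC
  have failure := (hA (PMF.uniformOfFintype Z) f hf _ (isSTAT_expect _ hτ)).2
  simp only [hε.trans_le (err_nonneg _ _ _), Set.ofPred_true, MeasureTheory.measure_univ,
    ENNReal.one_le_ofReal] at failure
  exact hδ.not_ge failure

lemma sqrt_two_mul_pow_mul_rpow_sq_le {x : ℝ} (hx : 0 < x) (m k : ℕ) :
    √(2 * x ^ (m + k)) * (x ^ (((m : ℝ) - k) / 4)) ^ 2 ≤ 2 * x ^ m := by
  have pow_four : (x ^ (((m : ℝ) - k) / 4)) ^ 4 * x ^ (m + k) = (x ^ m) ^ 2 := by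
    simp only [← Real.rpow_natCast, ← Real.rpow_mul hx.le, ← Real.rpow_add hx]
    push_cast
    ring_nf
  refine le_of_sq_le_sq ?_ (by positivity)
  calc (√(2 * x ^ (m + k)) * (x ^ (((m : ℝ) - k) / 4)) ^ 2) ^ 2
      = 2 * ((x ^ (((m : ℝ) - k) / 4)) ^ 4 * x ^ (m + k)) := by
        rw [mul_pow, Real.sq_sqrt (by positivity)]
        ring
    _ ≤ (2 * x ^ m) ^ 2 := by
        rw [pow_four, mul_pow]
        gcongr
        norm_num

theorem hypClass_lower_bound {δ : ℝ} (hδ : 0 ≤ δ) (hδ1 : δ < 1) :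
    ∃ c : ℝ, 0 < c ∧ ∀ (p : ℕ) [Fact p.Prime] (k n : ℕ), 1 ≤ k →
      ∃ t : ℝ, c * (p : ℝ) ^ ((((n + 1 : ℕ) : ℝ) - (k : ℝ)) / 4) ≤ t ∧ 0 < t ∧
        ∀ q : ℕ, RandLearnable k (hypClass p n) (1 / 2 - 2 / t) δ (1 / t) q → t ≤ q := by
  have h1δ : 0 < 1 - δ := sub_pos.2 hδ1
  refine ⟨√(1 - δ) / 2, by positivity, fun p hp k n hk => ?_⟩
  have : NeZero k := ⟨Nat.one_le_iff_ne_zero.1 hk⟩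
  have hp0 : (0 : ℝ) < p := by exact_mod_cast hp.out.pos
  set r : ℝ := (p : ℝ) ^ ((((n + 1 : ℕ) : ℝ) - (k : ℝ)) / 4)
  set t : ℝ := √(1 - δ) / 2 * r
  have ht0 : 0 < t := by positivity
  refine ⟨t, le_rfl, ht0, fun q hq => ?_⟩
  rcases lt_or_ge t 4 with ht4 | ht4
  · refine absurd hq (not_randLearnable_of_neg (Set.range_nonempty _) ?_ hδ1 (by positivity))
    rw [sub_neg, div_lt_div_iff₀ two_pos ht0]
    linarith
  have main := hq.hypClass_mul_card_le hδ (by positivity) (by field_simp; norm_num)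
  rw [mul_one_div, div_le_iff₀ ht0] at main
  by_contra! hqt
  have : (1 - δ) * (p : ℝ) ^ (n + 1) < (1 - δ) * (p : ℝ) ^ (n + 1) :=
    calc (1 - δ) * (p : ℝ) ^ (n + 1) ≤ (q + 1) * √(2 * (p : ℝ) ^ (n + 1 + k)) * t := main
      _ < 2 * t * √(2 * (p : ℝ) ^ (n + 1 + k)) * t := by gcongr; linarith
      _ = (1 - δ) / 2 * (√(2 * (p : ℝ) ^ (n + 1 + k)) * r ^ 2) := by
          linear_combination √(2 * (p : ℝ) ^ (n + 1 + k)) * r ^ 2 / 2 * Real.sq_sqrt h1δ.le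
      _ ≤ (1 - δ) / 2 * (2 * (p : ℝ) ^ (n + 1)) := mul_le_mul_of_nonneg_left
          (sqrt_two_mul_pow_mul_rpow_sq_le hp0 (n + 1) k) (by positivity)
      _ = (1 - δ) * (p : ℝ) ^ (n + 1) := by ring
  exact this.false

end LowerBound

section Separation

variable {Z : Type} [Fintype Z] {k : ℕ} {C : Set (Z → ℤˣ)}

lemma RandLearnable.mono {ε ε' δ τ τ' : ℝ} {q : ℕ} (h : RandLearnable k C ε δ τ q)
    (hε : ε ≤ ε') (hτ : τ' ≤ τ) : RandLearnable k C ε' δ τ' q := by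
  obtain ⟨Ω, m, μ, hμ, A, hA⟩ := h
  refine ⟨Ω, m, μ, hμ, A, fun P f hf O hO => ?_⟩
  obtain ⟨hq, hfail⟩ := hA P f hf O fun φ => (hO φ).trans hτ
  exact ⟨hq, (MeasureTheory.measure_mono fun ω hω => hε.trans_lt hω).trans hfail⟩

lemma DetLearnable.randLearnable {ε τ : ℝ} {q : ℕ} (h : DetLearnable k C ε τ q) (δ : ℝ) :
    RandLearnable k C ε δ τ q := by
  obtain ⟨A, hA⟩ := h
  refine ⟨Unit, ⊤, MeasureTheory.Measure.dirac (), inferInstance, fun _ => A,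
    fun P f hf O hO => ⟨fun _ => (hA P f hf O hO).1, ?_⟩⟩
  have no_failure : {_ω : Unit | ε < err P f (A.run O)} = ∅ :=
    Set.eq_empty_of_forall_notMem fun _ hω => not_lt.2 (hA P f hf O hO).2 hω
  rw [no_failure, MeasureTheory.measure_empty]
  exact zero_le

lemma RandLearnable.sqComplexity_le {ε δ : ℝ} {m : ℕ}
    (h : RandLearnable k C ε δ (1 / (m : ℝ)) m) (hm : 0 < m) : sqComplexity k C ε δ ≤ m :=
  iInf₂_le m ⟨hm, h⟩

lemma ofReal_le_sqComplexity {ε δ b : ℝ}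
    (h : ∀ m : ℕ, 0 < m → RandLearnable k C ε δ (1 / (m : ℝ)) m → b ≤ m) :
    ENNReal.ofReal b ≤ (sqComplexity k C ε δ : ENNReal) := by
  have ceil_le : ((⌈b⌉₊ : ℕ) : ℕ∞) ≤ sqComplexity k C ε δ :=
    le_iInf₂ fun m hm => by exact_mod_cast Nat.ceil_le.2 (h m hm.1 hm.2)
  calc ENNReal.ofReal b ≤ ENNReal.ofReal ⌈b⌉₊ := ENNReal.ofReal_le_ofReal (Nat.le_ceil b)
    _ = ((⌈b⌉₊ : ℕ∞) : ENNReal) := by rw [ENat.toENNReal_coe, ENNReal.ofReal_natCast]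
    _ ≤ sqComplexity k C ε δ := ENat.toENNReal_le.2 ceil_le

lemma DetLearnable.sqComplexity_le {ε a : ℝ} {t : ℕ} (h : DetLearnable k C ε (a / t) t)
    (ht : 0 < t) (ha : 0 < a) (ha1 : a ≤ 1) (δ : ℝ) :
    (sqComplexity k C ε δ : ENNReal) ≤ ENNReal.ofReal (2 / a * t) := by
  let m := ⌈(t : ℝ) / a⌉₊
  have ht1 : (1 : ℝ) ≤ t := by exact_mod_cast ht
  have le_div : (t : ℝ) ≤ t / a := le_div_self (Nat.cast_nonneg t) ha ha1
  have div_le : (t : ℝ) / a ≤ m := Nat.le_ceil _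
  have le_m : t ≤ m := by exact_mod_cast le_div.trans div_le
  have hm : 0 < m := ht.trans_le le_m
  have tolerance : 1 / (m : ℝ) ≤ a / t := by
    rw [div_le_div_iff₀ (by positivity) (by positivity), one_mul, mul_comm]
    exact (div_le_iff₀ ha).1 div_le
  calc (sqComplexity k C ε δ : ENNReal) ≤ ((m : ℕ∞) : ENNReal) :=
        ENat.toENNReal_le.2 <|
          ((h.mono le_rfl tolerance le_m).randLearnable δ).sqComplexity_le hm
    _ = ENNReal.ofReal m := by rw [ENat.toENNReal_coe, ENNReal.ofReal_natCast]
    _ ≤ ENNReal.ofReal (2 / a * t) := ENNReal.ofReal_le_ofReal <|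
        calc (m : ℝ) ≤ t / a + 1 := (Nat.ceil_lt_add_one (by positivity)).le
          _ ≤ t / a + t / a := by linarith
          _ = 2 / a * t := by ring

lemma sqComplexity_hypClass_le (k : ℕ) {ε : ℝ} (hε : 0 < ε) (hε1 : ε ≤ 1) (δ : ℝ) :
    ∃ c : ℝ, 0 < c ∧ ∀ (p : ℕ) [Fact p.Prime],
      (sqComplexity (k + 1) (hypClass p k) ε δ : ENNReal) ≤ ENNReal.ofReal (c * Real.log p) := by
  obtain ⟨c, hc, h⟩ := hypClass_upper_bound k
  refine ⟨2 / ε ^ (k + 1) * c, by positivity, fun p hp => ?_⟩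
  obtain ⟨t, ht, htc, hlearn⟩ := h p
  refine ((hlearn ε hε).sqComplexity_le ht (by positivity) (pow_le_one₀ hε.le hε1) δ).trans ?_
  rw [mul_assoc]
  gcongr

lemma le_sqComplexity_hypClass {ε δ : ℝ} (hε : ε < 1 / 2) (hδ : 0 ≤ δ) (hδ1 : δ < 1) :
    ∃ c : ℝ, 0 < c ∧ ∀ (p : ℕ) [Fact p.Prime] (k : ℕ), 1 ≤ k →
      ENNReal.ofReal (c * (p : ℝ) ^ (1 / 4 : ℝ)) ≤
        (sqComplexity k (hypClass p k) ε δ : ENNReal) := by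
  obtain ⟨c, hc, h⟩ := hypClass_lower_bound hδ hδ1
  have gap : 0 < 1 / 2 - ε := sub_pos.2 hε
  let s := max 1 (2 / (1 / 2 - ε))
  have hs : 0 < s := lt_max_of_lt_left one_pos
  refine ⟨c / s, by positivity, fun p hp k hk => ofReal_le_sqComplexity fun m hm hlearn => ?_⟩
  obtain ⟨t, hct, ht0, ht⟩ := h p k k hk
  have exponent : (((k + 1 : ℕ) : ℝ) - (k : ℝ)) / 4 = 1 / 4 := by
    push_cast
    ring
  rw [exponent] at hct
  have hm1 : (1 : ℝ) ≤ m := by exact_mod_cast hm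
  suffices t ≤ s * m by
    rw [div_mul_eq_mul_div, div_le_iff₀' hs]
    exact hct.trans this
  by_contra! hlt
  have s_lt : s < t := (le_mul_of_one_le_right hs.le hm1).trans_lt hlt
  have m_lt : m < t := (le_mul_of_one_le_left (by positivity) (le_max_left _ _)).trans_lt hlt
  have error : ε ≤ 1 / 2 - 2 / t := by
    have : 2 / t ≤ 1 / 2 - ε := by
      rw [div_le_comm₀ ht0 gap]
      exact (le_max_right _ _).trans s_lt.le
    linarith
  exact m_lt.not_ge (ht m (hlearn.mono error (one_div_le_one_div_of_le (by positivity) m_lt.le)))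

end Separation

end KWiseSQ

end

open KWiseSQ in
/-- With `ℓ = n + 1`, `hypClass p n` is the class over `𝔽_p^ℓ`; `hypClass p k` is the class over
`𝔽_p^(k+1)`. The three parts are the upper bound for `(k+1)`-wise queries, the lower bound for
`k`-wise queries, and the resulting separation of SQ complexities. -/
theorem theorem1 :
    (∀ k : ℕ, 1 ≤ k → ∃ c : ℝ, 0 < c ∧ ∀ (p : ℕ) [Fact p.Prime],
      ∃ t : ℕ, 1 ≤ t ∧ (t : ℝ) ≤ c * Real.log p ∧
        ∀ ε : ℝ, 0 < ε →
          DetLearnable (k + 1) (hypClass p k) ε (ε ^ (k + 1) / t) t) ∧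
    (∀ δ : ℝ, 0 ≤ δ → δ < 1 → ∃ c : ℝ, 0 < c ∧ ∀ (p : ℕ) [Fact p.Prime] (k n : ℕ),
      1 ≤ k → k + 1 ≤ n + 1 →
        ∃ t : ℝ, c * (p : ℝ) ^ ((((n + 1 : ℕ) : ℝ) - (k : ℝ)) / 4) ≤ t ∧
          ∀ q : ℕ, RandLearnable k (hypClass p n) (1 / 2 - 2 / t) δ (1 / t) q → t ≤ q) ∧
    (∀ (k : ℕ) (ε δ : ℝ), 1 ≤ k → 0 < ε → ε < 1 / 2 → 0 ≤ δ → δ < 1 →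
      ∃ c₁ c₂ : ℝ, 0 < c₁ ∧ 0 < c₂ ∧ ∀ (p : ℕ) [Fact p.Prime],
        (sqComplexity (k + 1) (hypClass p k) ε δ : ENNReal) ≤
            ENNReal.ofReal (c₁ * Real.log p) ∧
          ENNReal.ofReal (c₂ * (p : ℝ) ^ (1 / 4 : ℝ)) ≤
            (sqComplexity k (hypClass p k) ε δ : ENNReal)) := by
  refine ⟨fun k _ => hypClass_upper_bound k, fun δ hδ hδ1 => ?_,
    fun k ε δ hk hε hε2 hδ hδ1 => ?_⟩
  · obtain ⟨c, hc, h⟩ := hypClass_lower_bound hδ hδ1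
    refine ⟨c, hc, fun p hp k n hk _ => ?_⟩
    obtain ⟨t, hct, -, ht⟩ := h p k n hk
    exact ⟨t, hct, ht⟩
  · obtain ⟨c₁, hc₁, h₁⟩ := sqComplexity_hypClass_le k hε (by linarith) δ
    obtain ⟨c₂, hc₂, h₂⟩ := le_sqComplexity_hypClass hε2 hδ hδ1
    exact ⟨c₁, c₂, hc₁, hc₂, fun p hp => ⟨h₁ p, h₂ p k hk⟩⟩
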